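/- Let $k$ be a field, let $n\ge 0$ be an integer, and let $R=k\langle x_0,\dots,x_n\rangle$ be the free algebra, $\mathbb Z$-graded by $\deg x_i=1$. Let $L=L(1,n+1)$ be the Leavitt algebra, i.e. the $k$-algebra generated by $x_0,\dots,x_n,x_0^*,\dots,x_n^*$ subject to the relations $$x_ix_i^*=1 \ \ (0\le i\le n),\qquad x_ix_j^*=0 \ \ (i\ne j),\qquad x_0^*x_0+\cdots+x_n^*x_n=1,$$ $\mathbb Z$-graded by $\deg x_i=1$ and $\deg x_i^*=-1$; let $R\to L$ be the graded algebra homomorphism $x_i\mapsto x_i$. For a $\mathbb Z$-graded $k$-algebra $A$, let $\mathsf{Gr}\,A$ be the category of $\mathbb Z$-graded left $A$-modules and degree-preserving homomorphisms. Let $\mathsf{Fdim}\,R\subset\mathsf{Gr}\,R$ be the full subcategory of direct limits of finite-dimensional graded modules, let $\mathsf{QGr}\,R=\mathsf{Gr}\,R/\mathsf{Fdim}\,R$ be the quotient category (the localization of $\mathsf{Gr}\,R$ at the homomorphisms whose kernel and cokernel belong to $\mathsf{Fdim}\,R$), and let $\pi^*:\mathsf{Gr}\,R\to\mathsf{QGr}\,R$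 be the quotient functor. Let $S=\varinjlim_i S_i$, where $S_i=M_{n+1}(k)^{\otimes i}$ and the transition maps $S_i\to S_{i+1}=M_{n+1}(k)\otimes_k S_i$ are $a\mapsto 1\otimes a$. Then: 1. $L$ is strongly graded, i.e. $L_iL_j=L_{i+j}$ for all $i,j\in\mathbb Z$. 2. $L_0\cong S$ as $k$-algebras. 3. There is an equivalence of categories $\alpha^*:\mathsf{QGr}\,R\to\mathsf{Gr}\,L$ such that $\alpha^*\pi^*=L\otimes_R-$ as functors $\mathsf{Gr}\,R\to\mathsf{Gr}\,L$. 4. The functor $M\mapsto M_0$ is an equivalence from $\mathsf{Gr}\,L$ to the category $\mathsf{Mod}\,L_0$ of left $L_0$-modules. In particular $\mathsf{QGr}\,R\equiv\mathsf{Gr}\,L\equiv\mathsf{Mod}\,L_0$. -/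

import Mathlib

universe u

open CategoryTheory DirectSum TensorProduct

namespace NCProj

noncomputable section

/-! ### Gradings of algebras by the weight of words in the generators -/

section WordGrading

variable {k : Type u} [Field k] {A : Type u} [Ring A] [Algebra k A] {X : Type}

/-- The span of all words in the elements `g x` that have total weight `j`, where `g x` has
weight `wt x`. -/
def wordGrading (k : Type u) [Field k] {A : Type u} [Ring A] [Algebra k A]
    (g : X → A) (wt : X → ℤ) (j : ℤ) : Submodule k A :=
  Submodule.span k {a | ∃ l : List X, (l.map wt).sum = j ∧ (l.map g).prod = a}

theorem prod_mem_wordGrading (g : X → A) (wt : X → ℤ) (l : List X) :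
    (l.map g).prod ∈ wordGrading k g wt (l.map wt).sum :=
  Submodule.subset_span ⟨l, rfl, rfl⟩

theorem gen_mem_wordGrading (g : X → A) (wt : X → ℤ) (x : X) :
    g x ∈ wordGrading k g wt (wt x) :=
  Submodule.subset_span ⟨[x], by simp, by simp⟩

instance wordGrading_gradedMonoid (g : X → A) (wt : X → ℤ) :
    SetLike.GradedMonoid (wordGrading k g wt) where
  one_mem := Submodule.subset_span ⟨[], by simp, by simp⟩
  mul_mem := by
    intro i j a b ha hb
    have h := Submodule.mul_mem_mul ha hb
    rw [wordGrading, wordGrading, Submodule.span_mul_span] at h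
    refine Submodule.span_mono ?_ h
    rintro _ ⟨a, ⟨l, hl, rfl⟩, b, ⟨l', hl', rfl⟩, rfl⟩
    exact ⟨l ++ l', by simp [hl, hl'], by simp⟩

theorem wordGrading_hom_apply (g : X → A) (wt : X → ℤ)
    (f : A →ₐ[k] ⨁ j, wordGrading k g wt j)
    (hf : ∀ x, f (g x) = DirectSum.of (fun j => wordGrading k g wt j) (wt x)
      ⟨g x, gen_mem_wordGrading g wt x⟩)
    (j : ℤ) (a : wordGrading k g wt j) :
    f a = DirectSum.of (fun j => wordGrading k g wt j) j a := by
  have key : ∀ l : List X, f (l.map g).prod =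
      DirectSum.of (fun j => wordGrading k g wt j) (l.map wt).sum
        ⟨(l.map g).prod, prod_mem_wordGrading g wt l⟩ := by
    intro l
    induction l with
    | nil => simp only [List.map_nil, List.prod_nil, map_one]; rfl
    | cons x l ih =>
      simp only [List.map_cons, List.prod_cons, map_mul, hf, ih, DirectSum.of_mul_of]
      rfl
  obtain ⟨a, ha⟩ := a
  change f a = DirectSum.lof k ℤ (fun j => wordGrading k g wt j) j ⟨a, ha⟩
  induction ha using Submodule.span_induction with
  | mem a h =>
    obtain ⟨l, rfl, rfl⟩ := h
    exact key l
  | zero =>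
    rw [map_zero]
    exact (map_zero (DirectSum.lof k ℤ (fun j => wordGrading k g wt j) j)).symm
  | add a b ha hb iha ihb =>
    rw [map_add, iha, ihb, ← map_add]; rfl
  | smul c a ha iha =>
    rw [map_smul, iha, ← map_smul]; rfl

end WordGrading

/-! ### The free algebra, the Leavitt algebra and the direct limit of matrix algebras -/

section Algebras

variable (k : Type u) [Field k] (n : ℕ)

/-- The free algebra `R = k⟨x₀, …, xₙ⟩`. -/
abbrev FreeAlg : Type u := FreeAlgebra k (Fin (n + 1))

/-- The `ℤ`-grading of `R` with `deg xᵢ = 1`. -/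
def freeGrading : ℤ → Submodule k (FreeAlg k n) :=
  wordGrading k (FreeAlgebra.ι k) (fun _ => 1)

instance : GradedAlgebra (freeGrading k n) :=
  letI : SetLike.GradedMonoid (freeGrading k n) := wordGrading_gradedMonoid _ _
  GradedAlgebra.ofAlgHom (freeGrading k n)
    (FreeAlgebra.lift k fun x => DirectSum.of (fun j => freeGrading k n j) 1
      ⟨FreeAlgebra.ι k x, gen_mem_wordGrading (FreeAlgebra.ι k) (fun _ => 1) x⟩)
    (by
      ext x
      simp)
    (fun j a => wordGrading_hom_apply (FreeAlgebra.ι k) (fun _ => 1) _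
      (fun x => FreeAlgebra.lift_ι_apply
        (fun x => DirectSum.of (fun j => freeGrading k n j) 1
          ⟨FreeAlgebra.ι k x, gen_mem_wordGrading (FreeAlgebra.ι k) (fun _ => 1) x⟩) x) j a)

/-- The defining relations of the Leavitt algebra; `inl i` stands for `xᵢ` and `inr i` for
`xᵢ*`. -/
inductive LeavittRel :
    FreeAlgebra k (Fin (n + 1) ⊕ Fin (n + 1)) → FreeAlgebra k (Fin (n + 1) ⊕ Fin (n + 1)) → Prop
  | x_mul_xs_self (i : Fin (n + 1)) :
      LeavittRel (FreeAlgebra.ι k (Sum.inl i) * FreeAlgebra.ι k (Sum.inr i)) 1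
  | x_mul_xs_ne (i j : Fin (n + 1)) (h : i ≠ j) :
      LeavittRel (FreeAlgebra.ι k (Sum.inl i) * FreeAlgebra.ι k (Sum.inr j)) 0
  | sum_xs_mul_x :
      LeavittRel (∑ i, FreeAlgebra.ι k (Sum.inr i) * FreeAlgebra.ι k (Sum.inl i)) 1

/-- The Leavitt algebra `L = L(1, n + 1)`. -/
def Leavitt : Type u := RingQuot (LeavittRel k n)

instance : Ring (Leavitt k n) := inferInstanceAs (Ring (RingQuot (LeavittRel k n)))

instance : Algebra k (Leavitt k n) := inferInstanceAs (Algebra k (RingQuot (LeavittRel k n)))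

/-- The generators `xᵢ` (`inl i`) and `xᵢ*` (`inr i`) of `L`. -/
def Leavitt.gen (s : Fin (n + 1) ⊕ Fin (n + 1)) : Leavitt k n :=
  RingQuot.mkAlgHom k (LeavittRel k n) (FreeAlgebra.ι k s)

/-- The degrees of the generators of `L`: `deg xᵢ = 1` and `deg xᵢ* = -1`. -/
def Leavitt.wt : Fin (n + 1) ⊕ Fin (n + 1) → ℤ
  | Sum.inl _ => 1
  | Sum.inr _ => -1

/-- The `ℤ`-grading of `L` with `deg xᵢ = 1` and `deg xᵢ* = -1`. -/
def leavittGrading : ℤ → Submodule k (Leavitt k n) :=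
  wordGrading k (Leavitt.gen k n) (Leavitt.wt n)

instance : SetLike.GradedMonoid (leavittGrading k n) := wordGrading_gradedMonoid _ _

theorem Leavitt.x_mul_xs_self (i : Fin (n + 1)) :
    Leavitt.gen k n (Sum.inl i) * Leavitt.gen k n (Sum.inr i) = 1 := by
  have h := RingQuot.mkAlgHom_rel k (LeavittRel.x_mul_xs_self (k := k) i)
  rw [map_mul, map_one] at h
  exact h

theorem Leavitt.x_mul_xs_ne (i j : Fin (n + 1)) (hij : i ≠ j) :
    Leavitt.gen k n (Sum.inl i) * Leavitt.gen k n (Sum.inr j) = 0 := by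
  have h := RingQuot.mkAlgHom_rel k (LeavittRel.x_mul_xs_ne (k := k) i j hij)
  rw [map_mul, map_zero] at h
  exact h

theorem Leavitt.sum_xs_mul_x :
    ∑ i, Leavitt.gen k n (Sum.inr i) * Leavitt.gen k n (Sum.inl i) = 1 := by
  have h := RingQuot.mkAlgHom_rel k (LeavittRel.sum_xs_mul_x (k := k) (n := n))
  rw [map_sum, map_one] at h
  simp only [map_mul] at h
  exact h

/-- The generators of `L` as homogeneous elements of `⨁ j, Lⱼ`. -/
def Leavitt.homGen (s : Fin (n + 1) ⊕ Fin (n + 1)) : ⨁ j, leavittGrading k n j :=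
  DirectSum.of (fun j => leavittGrading k n j) (Leavitt.wt n s)
    ⟨Leavitt.gen k n s, gen_mem_wordGrading (Leavitt.gen k n) (Leavitt.wt n) s⟩

theorem Leavitt.of_eq_of {i j : ℤ} (h : i = j) (a : leavittGrading k n i)
    (b : leavittGrading k n j) (hab : (a : Leavitt k n) = b) :
    DirectSum.of (fun j => leavittGrading k n j) i a =
      DirectSum.of (fun j => leavittGrading k n j) j b := by
  subst h
  rw [Subtype.ext hab]

theorem Leavitt.homGen_mul_eq (s t : Fin (n + 1) ⊕ Fin (n + 1))
    (h : Leavitt.wt n s + Leavitt.wt n t = 0)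
    (hm : Leavitt.gen k n s * Leavitt.gen k n t ∈ leavittGrading k n 0) :
    Leavitt.homGen k n s * Leavitt.homGen k n t =
      DirectSum.of (fun j => leavittGrading k n j) 0
        ⟨Leavitt.gen k n s * Leavitt.gen k n t, hm⟩ := by
  unfold Leavitt.homGen
  rw [DirectSum.of_mul_of]
  exact Leavitt.of_eq_of k n h _ _ rfl

theorem Leavitt.gen_mul_mem (s t : Fin (n + 1) ⊕ Fin (n + 1))
    (h : Leavitt.wt n s + Leavitt.wt n t = 0) :
    Leavitt.gen k n s * Leavitt.gen k n t ∈ leavittGrading k n 0 := by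
  have hm := SetLike.mul_mem_graded (A := leavittGrading k n)
    (gen_mem_wordGrading (Leavitt.gen k n) (Leavitt.wt n) s)
    (gen_mem_wordGrading (Leavitt.gen k n) (Leavitt.wt n) t)
  rwa [h] at hm

theorem Leavitt.sum_homGen :
    ∑ i, Leavitt.homGen k n (Sum.inr i) * Leavitt.homGen k n (Sum.inl i) = 1 := by
  have hw : ∀ i : Fin (n + 1), Leavitt.wt n (Sum.inr i) + Leavitt.wt n (Sum.inl i) = 0 :=
    fun i => by simp [Leavitt.wt]
  rw [Finset.sum_congr rfl fun i _ => Leavitt.homGen_mul_eq k n (Sum.inr i) (Sum.inl i) (hw i)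
    (Leavitt.gen_mul_mem k n _ _ (hw i)), ← map_sum, DirectSum.one_def]
  refine Leavitt.of_eq_of k n rfl _ _ ?_
  rw [AddSubmonoidClass.coe_finsetSum]
  exact Leavitt.sum_xs_mul_x k n

/-- The map `L → ⨁ j, Lⱼ` that decomposes an element into its homogeneous components. -/
def Leavitt.decomposeHom : Leavitt k n →ₐ[k] ⨁ j, leavittGrading k n j :=
  RingQuot.liftAlgHom k ⟨FreeAlgebra.lift k (Leavitt.homGen k n), by
    intro a b h
    cases h with
    | x_mul_xs_self i =>
      simp only [map_mul, FreeAlgebra.lift_ι_apply, map_one]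
      rw [Leavitt.homGen_mul_eq k n _ _ (by simp [Leavitt.wt])
        (Leavitt.gen_mul_mem k n _ _ (by simp [Leavitt.wt])), DirectSum.one_def]
      exact Leavitt.of_eq_of k n rfl _ _ (Leavitt.x_mul_xs_self k n i)
    | x_mul_xs_ne i j hij =>
      simp only [map_mul, FreeAlgebra.lift_ι_apply, map_zero]
      rw [Leavitt.homGen_mul_eq k n _ _ (by simp [Leavitt.wt])
        (Leavitt.gen_mul_mem k n _ _ (by simp [Leavitt.wt]))]
      exact (Leavitt.of_eq_of k n rfl _ 0 (Leavitt.x_mul_xs_ne k n i j hij)).trans (map_zero _)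
    | sum_xs_mul_x =>
      simp only [map_sum, map_mul, FreeAlgebra.lift_ι_apply, map_one]
      exact Leavitt.sum_homGen k n⟩

theorem Leavitt.decomposeHom_gen (s : Fin (n + 1) ⊕ Fin (n + 1)) :
    Leavitt.decomposeHom k n (Leavitt.gen k n s) = Leavitt.homGen k n s := by
  unfold Leavitt.decomposeHom Leavitt.gen
  refine (RingQuot.liftAlgHom_mkAlgHom_apply k _ _ _).trans ?_
  exact FreeAlgebra.lift_ι_apply _ _

instance : GradedAlgebra (leavittGrading k n) :=
  GradedAlgebra.ofAlgHom (leavittGrading k n) (Leavitt.decomposeHom k n)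
    (by
      refine RingQuot.ringQuot_ext' _ _ _ (FreeAlgebra.hom_ext (funext fun s => ?_))
      change DirectSum.coeAlgHom (leavittGrading k n)
        (Leavitt.decomposeHom k n (Leavitt.gen k n s)) = Leavitt.gen k n s
      rw [Leavitt.decomposeHom_gen, Leavitt.homGen, DirectSum.coeAlgHom_of])
    (fun j a => wordGrading_hom_apply (Leavitt.gen k n) (Leavitt.wt n) _
      (fun s => Leavitt.decomposeHom_gen k n s) j a)

/-- The canonical homomorphism `R → L`, `xᵢ ↦ xᵢ`. -/
def freeToLeavitt : FreeAlg k n →ₐ[k] Leavitt k n :=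
  FreeAlgebra.lift k fun i => Leavitt.gen k n (Sum.inl i)

theorem freeToLeavitt_mem (j : ℤ) (a : FreeAlg k n) (ha : a ∈ freeGrading k n j) :
    freeToLeavitt k n a ∈ leavittGrading k n j := by
  induction ha using Submodule.span_induction with
  | mem a h =>
    obtain ⟨l, rfl, rfl⟩ := h
    refine Submodule.subset_span ⟨l.map Sum.inl, ?_, ?_⟩
    · simp [List.map_map, Function.comp_def, Leavitt.wt]
    · rw [map_list_prod, List.map_map, List.map_map]
      congr 1
      refine List.map_congr_left fun x _ => ?_
      simp [freeToLeavitt]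
  | zero => rw [map_zero]; exact Submodule.zero_mem _
  | add a b ha hb iha ihb => rw [map_add]; exact Submodule.add_mem _ iha ihb
  | smul c a ha iha => rw [map_smul]; exact Submodule.smul_mem _ _ iha

/-- The algebras `Sᵢ = Mₙ₊₁(k)^{⊗ i}`, with `S₀ = k` and `Sᵢ₊₁ = Mₙ₊₁(k) ⊗ Sᵢ`. -/
def matPow : ℕ → AlgCat.{u} k
  | 0 => AlgCat.of k k
  | i + 1 => AlgCat.of k (Matrix (Fin (n + 1)) (Fin (n + 1)) k ⊗[k] matPow i)

/-- The map `θᵢ : Sᵢ → Sᵢ₊₁`, `a ↦ 1 ⊗ a`. -/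
def matPowSucc (i : ℕ) : matPow k n i →ₐ[k] matPow k n (i + 1) :=
  (Algebra.TensorProduct.includeRight :
    matPow k n i →ₐ[k] Matrix (Fin (n + 1)) (Fin (n + 1)) k ⊗[k] matPow k n i)

/-- The composite `θⱼ₋₁ ∘ ⋯ ∘ θᵢ : Sᵢ → Sⱼ`. -/
def matPowMap (i j : ℕ) (h : i ≤ j) : matPow k n i →ₐ[k] matPow k n j :=
  Nat.leRec (motive := fun j _ => matPow k n i →ₐ[k] matPow k n j) (AlgHom.id k _)
    (fun j _ f => (matPowSucc k n j).comp f) h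

instance : DirectedSystem (fun i => matPow k n i) (fun i j h => matPowMap k n i j h) where
  map_self i x := by
    simp [matPowMap]
  map_map := by
    intro l j i hij hjl x
    induction hjl using Nat.leRec with
    | refl => simp [matPowMap]
    | le_succ_of_le h ih =>
      have h1 : ∀ (a b : ℕ) (hab : a ≤ b) (y : matPow k n a),
          matPowMap k n a (b + 1) (hab.trans (Nat.le_succ b)) y =
            matPowSucc k n b (matPowMap k n a b hab y) := by
        intro a b hab y
        unfold matPowMap
        rw [Nat.leRec_succ _ _ hab]
        rfl
      rw [h1 _ _ h, h1 _ _ (hij.trans h), ih]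

/-- The direct limit `S` of the algebras `Sᵢ`. -/
abbrev MatLimit : Type u :=
  DirectLimit (fun i => matPow k n i) (fun i j h => matPowMap k n i j h)

end Algebras

/-- A `ℤ`-grading of an algebra is strong if `Aᵢ Aⱼ = Aᵢ₊ⱼ` for all `i` and `j`. -/
def IsStronglyGraded {k A : Type u} [Field k] [Ring A] [Algebra k A]
    (𝒜 : ℤ → Submodule k A) : Prop :=
  ∀ i j : ℤ, 𝒜 i * 𝒜 j = 𝒜 (i + j)

/-! ### The category of graded modules -/

/-- A `ℤ`-graded left module over a `ℤ`-graded algebra. -/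
structure GrMod {k A : Type u} [Field k] [Ring A] [Algebra k A]
    (𝒜 : ℤ → Submodule k A) : Type (u + 1) where
  carrier : Type u
  [addCommGroup : AddCommGroup carrier]
  [module : Module A carrier]
  deg : ℤ → AddSubgroup carrier
  isInternal : DirectSum.IsInternal deg
  smul_mem : ∀ {i j : ℤ} {a : A} {m : carrier}, a ∈ 𝒜 i → m ∈ deg j → a • m ∈ deg (i + j)

namespace GrMod

attribute [instance] GrMod.addCommGroup GrMod.module

section Basic

variable {k A : Type u} [Field k] [Ring A] [Algebra k A] {𝒜 : ℤ → Submodule k A}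

/-- Homomorphisms of graded modules: module homomorphisms that preserve degree. -/
@[ext]
structure Hom (M N : GrMod 𝒜) : Type u where
  toLin : M.carrier →ₗ[A] N.carrier
  map_deg : ∀ {i : ℤ} {m : M.carrier}, m ∈ M.deg i → toLin m ∈ N.deg i

instance : Category.{u} (GrMod 𝒜) where
  Hom M N := Hom M N
  id M := ⟨LinearMap.id, fun h => h⟩
  comp f g := ⟨g.toLin.comp f.toLin, fun h => g.map_deg (f.map_deg h)⟩

@[ext]
theorem hom_ext {M N : GrMod 𝒜} {f g : M ⟶ N} (h : f.toLin = g.toLin) : f = g :=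
  Hom.ext h

@[simp]
theorem id_toLin (M : GrMod 𝒜) : Hom.toLin (𝟙 M) = LinearMap.id := rfl

@[simp]
theorem comp_toLin {M N P : GrMod 𝒜} (f : M ⟶ N) (g : N ⟶ P) :
    Hom.toLin (f ≫ g) = g.toLin.comp f.toLin := rfl

instance decomposition (M : GrMod 𝒜) : DirectSum.Decomposition M.deg :=
  M.isInternal.chooseDecomposition

/-- A degree-preserving additive map commutes with taking homogeneous components. -/
theorem map_decompose {M N : GrMod 𝒜} (f : M ⟶ N) (m : M.carrier) (i : ℤ) :
    f.toLin (DirectSum.decompose M.deg m i) = DirectSum.decompose N.deg (f.toLin m) i := by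
  induction m using DirectSum.Decomposition.inductionOn M.deg with
  | zero => simp
  | @homogeneous j m =>
    rw [DirectSum.decompose_coe, DirectSum.decompose_of_mem N.deg (f.map_deg m.2)]
    by_cases h : j = i
    · subst h; simp
    · rw [DirectSum.of_eq_of_ne _ _ _ (Ne.symm h), DirectSum.of_eq_of_ne _ _ _ (Ne.symm h)]
      simp
  | add a b ha hb => simp [DirectSum.decompose_add, ha, hb]

/-- The kernel of a homomorphism of graded modules. -/
def ker {M N : GrMod 𝒜} (f : M ⟶ N) : GrMod 𝒜 where
  carrier := LinearMap.ker f.toLin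
  deg i := (M.deg i).comap (LinearMap.ker f.toLin).subtype.toAddMonoidHom
  isInternal := by
    classical
    constructor
    · rw [injective_iff_map_eq_zero]
      intro x hx
      have key : ∀ y : ⨁ i, ((M.deg i).comap (LinearMap.ker f.toLin).subtype.toAddMonoidHom),
          DirectSum.decompose M.deg ((DirectSum.coeAddMonoidHom _ y :
            LinearMap.ker f.toLin) : M.carrier) =
          DirectSum.map (fun i => ((LinearMap.ker f.toLin).subtype.toAddMonoidHom.addSubgroupComap
            (M.deg i))) y := by
        intro y
        induction y using DirectSum.induction_on with
        | zero => simp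
        | of i y =>
          rw [DirectSum.coeAddMonoidHom_of, DirectSum.map_of]
          exact DirectSum.decompose_of_mem M.deg y.2
        | add a b ha hb =>
          rw [map_add, map_add, ← ha, ← hb, Submodule.coe_add, DirectSum.decompose_add]
      have h := key x
      rw [hx, Submodule.coe_zero, DirectSum.decompose_zero] at h
      ext i
      have hi := congrArg (fun z => ((z i : M.deg i) : M.carrier)) h
      simp only [DirectSum.map_apply] at hi
      exact hi.symm
    · rintro ⟨m, hm⟩
      have hmem : ∀ i, ((DirectSum.decompose M.deg m i : M.deg i) : M.carrier) ∈
          LinearMap.ker f.toLin := by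
        intro i
        rw [LinearMap.mem_ker, map_decompose, LinearMap.mem_ker.1 hm]
        simp
      refine ⟨∑ i ∈ (DirectSum.decompose M.deg m).support, DirectSum.of
        (fun i => (M.deg i).comap (LinearMap.ker f.toLin).subtype.toAddMonoidHom) i
        ⟨⟨_, hmem i⟩, (DirectSum.decompose M.deg m i).2⟩, ?_⟩
      apply Subtype.ext
      rw [map_sum]
      simp only [DirectSum.coeAddMonoidHom_of]
      rw [AddSubmonoidClass.coe_finsetSum]
      exact DirectSum.sum_support_decompose M.deg m
  smul_mem ha hm := M.smul_mem ha hm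

/-- The cokernel of a homomorphism of graded modules. -/
def coker {M N : GrMod 𝒜} (f : M ⟶ N) : GrMod 𝒜 where
  carrier := N.carrier ⧸ LinearMap.range f.toLin
  deg i := (N.deg i).map (LinearMap.range f.toLin).mkQ.toAddMonoidHom
  isInternal := by
    classical
    let D : N.carrier →+
        ⨁ i, ((N.deg i).map (LinearMap.range f.toLin).mkQ.toAddMonoidHom) :=
      (DirectSum.map fun i => (LinearMap.range f.toLin).mkQ.toAddMonoidHom.addSubgroupMap
        (N.deg i)).comp (DirectSum.decomposeAddEquiv N.deg).toAddMonoidHom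
    have hD : ∀ x ∈ (LinearMap.range f.toLin).toAddSubgroup, D x = 0 := by
      rintro _ ⟨m, rfl⟩
      ext i
      change ((LinearMap.range f.toLin).mkQ
        (DirectSum.decompose N.deg (f.toLin m) i : N.deg i) : _ ⧸ _) = 0
      rw [← map_decompose]
      simp
    have hDof : ∀ i (x : N.deg i), D x = DirectSum.of
        (fun i => (N.deg i).map (LinearMap.range f.toLin).mkQ.toAddMonoidHom) i
        ⟨(LinearMap.range f.toLin).mkQ x, ⟨x, x.2, rfl⟩⟩ := by
      intro i x
      change DirectSum.map _ (DirectSum.decompose N.deg (x : N.carrier)) = _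
      rw [DirectSum.decompose_coe, DirectSum.map_of]
      rfl
    let _ : DirectSum.Decomposition
        fun i => (N.deg i).map (LinearMap.range f.toLin).mkQ.toAddMonoidHom :=
      DirectSum.Decomposition.ofAddHom _
        (QuotientAddGroup.lift (LinearMap.range f.toLin).toAddSubgroup D hD)
        (by
          refine AddMonoidHom.ext fun x => ?_
          obtain ⟨x, rfl⟩ := Submodule.Quotient.mk_surjective _ x
          change DirectSum.coeAddMonoidHom _ (D x) = (LinearMap.range f.toLin).mkQ x
          induction x using DirectSum.Decomposition.inductionOn N.deg with
          | zero => simp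
          | homogeneous x => rw [hDof, DirectSum.coeAddMonoidHom_of]
          | add a b ha hb => rw [map_add, map_add, map_add, ha, hb])
        (by
          ext i ⟨_, x, hx, rfl⟩ : 2
          refine Eq.trans ?_ (hDof i ⟨x, hx⟩)
          exact congrArg (QuotientAddGroup.lift (LinearMap.range f.toLin).toAddSubgroup D hD)
            (DirectSum.coeAddMonoidHom_of
              (fun i => (N.deg i).map (LinearMap.range f.toLin).mkQ.toAddMonoidHom) i
              ⟨(LinearMap.range f.toLin).mkQ x, AddSubgroup.mem_map_of_mem _ hx⟩))
    exact DirectSum.Decomposition.isInternal _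
  smul_mem := by
    rintro i j a _ ha ⟨m, hm, rfl⟩
    exact ⟨a • m, N.smul_mem ha hm, rfl⟩

variable (𝒜)

/-- The finite-dimensional graded modules (dimension over the base field `k`). -/
def finDim : ObjectProperty (GrMod 𝒜) :=
  fun M => Module.Finite k (RestrictScalars k A M.carrier)

/-- `Fdim`: the graded modules that are direct limits (filtered colimits in the category of
graded modules) of finite-dimensional graded modules. -/
def fdim : ObjectProperty (GrMod 𝒜) :=
  ObjectProperty.ind.{u} (finDim 𝒜)

/-- The homomorphisms whose kernel and cokernel belong to `Fdim`. -/
def isoModFdim : MorphismProperty (GrMod 𝒜) :=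
  fun _ _ f => fdim 𝒜 (ker f) ∧ fdim 𝒜 (coker f)

/-- The quotient category `QGr = Gr / Fdim`, that is, the localization of `Gr` at the
homomorphisms whose kernel and cokernel belong to `Fdim`. -/
abbrev QGr : Type (u + 1) := (isoModFdim 𝒜).Localization

/-- The quotient functor `π* : Gr ⥤ QGr`. -/
abbrev quotientFunctor : GrMod 𝒜 ⥤ QGr 𝒜 := (isoModFdim 𝒜).Q

end Basic

/-! ### The degree-zero functor -/

section DegreeZero

variable {k A : Type u} [Field k] [Ring A] [Algebra k A] (𝒜 : ℤ → Submodule k A)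
  [GradedAlgebra 𝒜]

/-- The component of degree zero is a left module over `A₀`. -/
instance degZeroModule (M : GrMod 𝒜) : Module (𝒜 0) (M.deg 0) where
  smul a m := ⟨(a : A) • (m : M.carrier), by simpa using M.smul_mem a.2 m.2⟩
  one_smul m := Subtype.ext (one_smul A (m : M.carrier))
  mul_smul a b m := Subtype.ext (mul_smul (a : A) (b : A) (m : M.carrier))
  smul_zero a := Subtype.ext (smul_zero (a : A))
  smul_add a m m' := Subtype.ext (smul_add (a : A) (m : M.carrier) m')
  add_smul a b m := Subtype.ext (add_smul (a : A) (b : A) (m : M.carrier))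
  zero_smul m := Subtype.ext (zero_smul A (m : M.carrier))

/-- The functor `M ↦ M₀` from graded left `A`-modules to left `A₀`-modules. -/
def degZero : GrMod 𝒜 ⥤ ModuleCat.{u} (𝒜 0) where
  obj M := ModuleCat.of (𝒜 0) (M.deg 0)
  map f := ModuleCat.ofHom
    { toFun := fun m => ⟨f.toLin m, f.map_deg m.2⟩
      map_add' := fun m m' => Subtype.ext (map_add f.toLin m.1 m'.1)
      map_smul' := fun a m => Subtype.ext (map_smul f.toLin (a : A) m.1) }

end DegreeZero

/-! ### Extension of scalars along a homomorphism of graded algebras -/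

section BaseChange

variable {k A B : Type u} [Field k] [Ring A] [Algebra k A] [Ring B] [Algebra k B]
  {𝒜 : ℤ → Submodule k A} {ℬ : ℤ → Submodule k B}

/-- The relations `b a ⊗ m = b ⊗ a m` in `B ⊗_ℤ M`, where `A` acts on the right of `B` through
`φ`. The set of these relations is stable under `B`, so that the `B`-submodule spanned by it is
also the additive subgroup generated by it. -/
def tensorRel (φ : A →ₐ[k] B) (M : Type u) [AddCommGroup M] [Module A M] :
    Submodule B (B ⊗[ℤ] M) :=
  Submodule.span B {t | ∃ (b : B) (a : A) (m : M), (b * φ a) ⊗ₜ[ℤ] m - b ⊗ₜ[ℤ] (a • m) = t}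

/-- The tensor product `B ⊗_A M` over the noncommutative ring `A`, as a left `B`-module. -/
abbrev Tensor (φ : A →ₐ[k] B) (M : Type u) [AddCommGroup M] [Module A M] : Type u :=
  (B ⊗[ℤ] M) ⧸ tensorRel φ M

/-- The element `b ⊗ m` of `B ⊗_A M`. -/
def tmk (φ : A →ₐ[k] B) {M : Type u} [AddCommGroup M] [Module A M] (b : B) (m : M) :
    Tensor φ M :=
  (tensorRel φ M).mkQ (b ⊗ₜ[ℤ] m)

/-- The component of degree `j` of `B ⊗_A M`: the additive group generated by the `b ⊗ m` with
`b` and `m` homogeneous and `deg b + deg m = j`. -/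
def tensorDeg (ℬ : ℤ → Submodule k B) (φ : A →ₐ[k] B) (M : GrMod 𝒜) (j : ℤ) :
    AddSubgroup (Tensor φ M.carrier) :=
  AddSubgroup.closure
    {t | ∃ (p q : ℤ) (b : B) (m : M.carrier),
      b ∈ ℬ p ∧ m ∈ M.deg q ∧ p + q = j ∧ tmk φ b m = t}

theorem tmk_mul (φ : A →ₐ[k] B) {M : Type u} [AddCommGroup M] [Module A M] (b : B) (a : A)
    (m : M) : tmk φ (b * φ a) m = tmk φ b (a • m) := by
  rw [← sub_eq_zero]
  unfold tmk
  rw [← map_sub]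
  exact (Submodule.Quotient.mk_eq_zero _).2 (Submodule.subset_span ⟨b, a, m, rfl⟩)

theorem smul_tmk (φ : A →ₐ[k] B) {M : Type u} [AddCommGroup M] [Module A M] (c b : B) (m : M) :
    c • tmk φ b m = tmk φ (c * b) m := rfl

theorem tmk_mem (φ : A →ₐ[k] B) (M : GrMod 𝒜) {p q : ℤ} {b : B} {m : M.carrier}
    (hb : b ∈ ℬ p) (hm : m ∈ M.deg q) : tmk φ b m ∈ tensorDeg ℬ φ M (p + q) :=
  AddSubgroup.subset_closure ⟨p, q, b, m, hb, hm, rfl, rfl⟩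

/-- The map `(b, m) ↦ b ⊗ m` from `B_p × M_q` to the component of degree `p + q`. -/
def tensorComp (ℬ : ℤ → Submodule k B) (φ : A →ₐ[k] B) (M : GrMod 𝒜) (p q : ℤ) :
    ℬ p →+ M.deg q →+ tensorDeg ℬ φ M (p + q) :=
  AddMonoidHom.mk' (fun b => AddMonoidHom.mk' (fun m => ⟨tmk φ b.1 m.1, tmk_mem φ M b.2 m.2⟩)
    (fun m m' => Subtype.ext (by
      change tmk φ b.1 (m.1 + m'.1) = tmk φ b.1 m.1 + tmk φ b.1 m'.1
      unfold tmk; rw [TensorProduct.tmul_add, map_add])))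
    (fun b b' => AddMonoidHom.ext fun m => Subtype.ext (by
      change tmk φ (b.1 + b'.1) m.1 = tmk φ b.1 m.1 + tmk φ b'.1 m.1
      unfold tmk; rw [TensorProduct.add_tmul, map_add]))

/-- The biadditive map `B × M → ⨁ j, (B ⊗_A M)ⱼ` that sends homogeneous `b`, `m` to `b ⊗ m`. -/
def tensorBi (ℬ : ℤ → Submodule k B) [GradedAlgebra ℬ] (φ : A →ₐ[k] B) (M : GrMod 𝒜) :
    B →+ M.carrier →+ ⨁ j, tensorDeg ℬ φ M j :=
  ((AddMonoidHom.compHom.flip (DirectSum.decomposeAddEquiv M.deg).toAddMonoidHom).comp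
    (DirectSum.toAddMonoid fun p => AddMonoidHom.flip (DirectSum.toAddMonoid fun q =>
      AddMonoidHom.flip ((AddMonoidHom.compHom
        (DirectSum.of (fun j => tensorDeg ℬ φ M j) (p + q))).comp (tensorComp ℬ φ M p q))))).comp
    (DirectSum.decomposeAddEquiv ℬ).toAddMonoidHom

theorem tensorBi_apply [GradedAlgebra ℬ] (φ : A →ₐ[k] B) (M : GrMod 𝒜) {p q j : ℤ} {b : B} {m : M.carrier}
    (hb : b ∈ ℬ p) (hm : m ∈ M.deg q) (hj : p + q = j) :
    tensorBi ℬ φ M b m = DirectSum.of (fun j => tensorDeg ℬ φ M j) j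
      ⟨tmk φ b m, hj ▸ tmk_mem φ M hb hm⟩ := by
  subst hj
  simp [tensorBi, DirectSum.decompose_of_mem _ hb, DirectSum.decompose_of_mem _ hm]
  rfl

theorem tensorBi_balanced [GradedAlgebra 𝒜] [GradedAlgebra ℬ] (φ : A →ₐ[k] B) (hφ : ∀ j, ∀ a ∈ 𝒜 j, φ a ∈ ℬ j) (M : GrMod 𝒜)
    (b : B) (a : A) (m : M.carrier) :
    tensorBi ℬ φ M (b * φ a) m = tensorBi ℬ φ M b (a • m) := by
  induction b using DirectSum.Decomposition.inductionOn ℬ with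
  | zero => simp
  | add b b' h h' => simp only [add_mul, map_add, AddMonoidHom.add_apply, h, h']
  | @homogeneous p b =>
    induction a using DirectSum.Decomposition.inductionOn 𝒜 with
    | zero => simp
    | add a a' h h' =>
      simp only [map_add, mul_add, AddMonoidHom.add_apply, h, h', add_smul]
    | @homogeneous r a =>
      induction m using DirectSum.Decomposition.inductionOn M.deg with
      | zero => simp
      | add m m' h h' => simp only [map_add, h, h', smul_add]
      | @homogeneous q m =>
        rw [tensorBi_apply φ M (SetLike.mul_mem_graded b.2 (hφ r a a.2)) m.2 rfl,
          tensorBi_apply φ M b.2 (M.smul_mem a.2 m.2) (add_assoc p r q).symm]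
        congr 1
        exact Subtype.ext (tmk_mul φ _ _ _)

/-- The decomposition of an element of `B ⊗_ℤ M`. -/
def tensorDecInt (ℬ : ℤ → Submodule k B) [GradedAlgebra ℬ] (φ : A →ₐ[k] B) (M : GrMod 𝒜) :
    B ⊗[ℤ] M.carrier →+ ⨁ j, tensorDeg ℬ φ M j :=
  TensorProduct.liftAddHom (tensorBi ℬ φ M) (fun r b m => by
    rw [map_zsmul, map_zsmul, AddMonoidHom.zsmul_apply])

theorem tensorDecInt_tmul [GradedAlgebra ℬ] (φ : A →ₐ[k] B) (M : GrMod 𝒜) (b : B) (m : M.carrier) :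
    tensorDecInt ℬ φ M (b ⊗ₜ m) = tensorBi ℬ φ M b m := rfl

theorem tensorDecInt_rel [GradedAlgebra 𝒜] [GradedAlgebra ℬ] (φ : A →ₐ[k] B)
    (hφ : ∀ j, ∀ a ∈ 𝒜 j, φ a ∈ ℬ j) (M : GrMod 𝒜)
    (t : B ⊗[ℤ] M.carrier) (ht : t ∈ (tensorRel φ M.carrier).toAddSubgroup) :
    tensorDecInt ℬ φ M t = 0 := by
  have key : ∀ c : B, tensorDecInt ℬ φ M (c • t) = 0 := by
    change t ∈ Submodule.span B _ at ht
    induction ht using Submodule.span_induction with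
    | mem t h =>
      obtain ⟨b, a, m, rfl⟩ := h
      intro c
      rw [smul_sub, TensorProduct.smul_tmul', TensorProduct.smul_tmul', smul_eq_mul, smul_eq_mul,
        ← mul_assoc, map_sub, tensorDecInt_tmul, tensorDecInt_tmul,
        tensorBi_balanced φ hφ, sub_self]
    | zero => simp
    | add s t _ _ hs ht =>
      intro c
      rw [smul_add, map_add, hs, ht, add_zero]
    | smul d t _ ht =>
      intro c
      rw [← mul_smul]
      exact ht _
  simpa using key 1

/-- The decomposition of an element of `B ⊗_A M` into homogeneous components. -/
def tensorDec [GradedAlgebra 𝒜] [GradedAlgebra ℬ] (φ : A →ₐ[k] B)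
    (hφ : ∀ j, ∀ a ∈ 𝒜 j, φ a ∈ ℬ j) (M : GrMod 𝒜) :
    Tensor φ M.carrier →+ ⨁ j, tensorDeg ℬ φ M j :=
  QuotientAddGroup.lift (tensorRel φ M.carrier).toAddSubgroup (tensorDecInt ℬ φ M)
    (tensorDecInt_rel φ hφ M)

theorem tensorDec_tmk [GradedAlgebra 𝒜] [GradedAlgebra ℬ] (φ : A →ₐ[k] B)
    (hφ : ∀ j, ∀ a ∈ 𝒜 j, φ a ∈ ℬ j) (M : GrMod 𝒜) (b : B) (m : M.carrier) :
    tensorDec φ hφ M (tmk φ b m) = tensorBi ℬ φ M b m := rfl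

theorem coe_tensorBi [GradedAlgebra ℬ] (φ : A →ₐ[k] B) (M : GrMod 𝒜) (b : B) (m : M.carrier) :
    DirectSum.coeAddMonoidHom (tensorDeg ℬ φ M) (tensorBi ℬ φ M b m) = tmk φ b m := by
  induction b using DirectSum.Decomposition.inductionOn ℬ with
  | zero => simp [tmk]
  | add b b' h h' =>
    simp only [map_add, AddMonoidHom.add_apply, h, h']
    simp only [tmk, TensorProduct.add_tmul, map_add]
  | @homogeneous p b =>
    induction m using DirectSum.Decomposition.inductionOn M.deg with
    | zero => simp [tmk]
    | add m m' h h' =>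
      simp only [map_add, h, h']
      simp only [tmk, TensorProduct.tmul_add, map_add]
    | @homogeneous q m =>
      rw [tensorBi_apply φ M b.2 m.2 rfl, DirectSum.coeAddMonoidHom_of]

theorem tensorDeg_isInternal [GradedAlgebra 𝒜] [GradedAlgebra ℬ] (φ : A →ₐ[k] B)
    (hφ : ∀ j, ∀ a ∈ 𝒜 j, φ a ∈ ℬ j) (M : GrMod 𝒜) :
    DirectSum.IsInternal (tensorDeg ℬ φ M) := by
  let _ : DirectSum.Decomposition (tensorDeg ℬ φ M) :=
    DirectSum.Decomposition.ofAddHom _ (tensorDec φ hφ M)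
      (by
        refine AddMonoidHom.ext fun x => ?_
        obtain ⟨t, rfl⟩ := Submodule.Quotient.mk_surjective _ x
        induction t using TensorProduct.induction_on with
        | zero => exact map_zero _
        | tmul b m => exact coe_tensorBi φ M b m
        | add s t hs ht =>
          rw [Submodule.Quotient.mk_add, map_add, hs, ht, map_add])
      (by
        refine DirectSum.addHom_ext fun j x => ?_
        rw [AddMonoidHom.comp_apply, DirectSum.coeAddMonoidHom_of, AddMonoidHom.id_apply]
        obtain ⟨x, hx⟩ := x
        induction hx using AddSubgroup.closure_induction with
        | mem x h =>
          obtain ⟨p, q, b, m, hb, hm, hj, rfl⟩ := h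
          exact (tensorDec_tmk φ hφ M b m).trans (tensorBi_apply φ M hb hm hj)
        | zero =>
          exact (map_zero (tensorDec φ hφ M)).trans
            (map_zero (DirectSum.of (fun j => tensorDeg ℬ φ M j) j)).symm
        | add x y hx hy ihx ihy =>
          refine (map_add (tensorDec φ hφ M) x y).trans ?_
          refine (congrArg₂ (· + ·) ihx ihy).trans ?_
          exact (map_add (DirectSum.of (fun j => tensorDeg ℬ φ M j) j) ⟨x, hx⟩ ⟨y, hy⟩).symm
        | neg x hx ihx =>
          refine (map_neg (tensorDec φ hφ M) x).trans ?_
          refine (congrArg Neg.neg ihx).trans ?_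
          exact (map_neg (DirectSum.of (fun j => tensorDeg ℬ φ M j) j) ⟨x, hx⟩).symm)
  exact DirectSum.Decomposition.isInternal _

/-- The graded left `B`-module `B ⊗_A M`. -/
def baseChangeObj [GradedAlgebra 𝒜] [GradedAlgebra ℬ] (φ : A →ₐ[k] B)
    (hφ : ∀ j, ∀ a ∈ 𝒜 j, φ a ∈ ℬ j) (M : GrMod 𝒜) : GrMod ℬ where
  carrier := Tensor φ M.carrier
  deg := tensorDeg ℬ φ M
  isInternal := tensorDeg_isInternal φ hφ M
  smul_mem := by
    intro i j c t hc ht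
    induction ht using AddSubgroup.closure_induction with
    | mem t h =>
      obtain ⟨p, q, b, m, hb, hm, rfl, rfl⟩ := h
      rw [smul_tmk, ← add_assoc]
      exact tmk_mem φ M (SetLike.mul_mem_graded hc hb) hm
    | zero => rw [smul_zero]; exact AddSubgroup.zero_mem _
    | add s t _ _ hs ht => rw [smul_add]; exact AddSubgroup.add_mem _ hs ht
    | neg t _ ht => rw [smul_neg]; exact AddSubgroup.neg_mem _ ht

/-- The map `B ⊗_A M → B ⊗_A N`, `b ⊗ m ↦ b ⊗ f m`. -/
def tensorMap (φ : A →ₐ[k] B) {M N : Type u} [AddCommGroup M] [Module A M] [AddCommGroup N]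
    [Module A N] (f : M →ₗ[A] N) : Tensor φ M →ₗ[B] Tensor φ N :=
  Submodule.mapQ (tensorRel φ M) (tensorRel φ N)
    (TensorProduct.AlgebraTensorModule.map (LinearMap.id : B →ₗ[B] B)
      f.toAddMonoidHom.toIntLinearMap)
    (Submodule.span_le.2 (by
      rintro _ ⟨b, a, m, rfl⟩
      refine Submodule.subset_span ⟨b, a, f m, ?_⟩
      rw [map_sub, ← map_smul f a m]
      rfl))

theorem tensorMap_tmk (φ : A →ₐ[k] B) {M N : Type u} [AddCommGroup M] [Module A M]
    [AddCommGroup N] [Module A N] (f : M →ₗ[A] N) (b : B) (m : M) :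
    tensorMap φ f (tmk φ b m) = tmk φ b (f m) := rfl

theorem tensorMap_mem (φ : A →ₐ[k] B) {M N : GrMod 𝒜} (f : M ⟶ N) {j : ℤ}
    {t : Tensor φ M.carrier} (ht : t ∈ tensorDeg ℬ φ M j) :
    tensorMap φ f.toLin t ∈ tensorDeg ℬ φ N j := by
  induction ht using AddSubgroup.closure_induction with
  | mem t h =>
    obtain ⟨p, q, b, m, hb, hm, rfl, rfl⟩ := h
    exact tmk_mem φ N hb (f.map_deg hm)
  | zero => rw [map_zero]; exact AddSubgroup.zero_mem _
  | add s t _ _ hs ht => rw [map_add]; exact AddSubgroup.add_mem _ hs ht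
  | neg t _ ht => rw [map_neg]; exact AddSubgroup.neg_mem _ ht

theorem tensor_hom_ext (φ : A →ₐ[k] B) {M : Type u} [AddCommGroup M] [Module A M]
    {P : Type u} [AddCommGroup P] [Module B P] {f g : Tensor φ M →ₗ[B] P}
    (h : ∀ b m, f (tmk φ b m) = g (tmk φ b m)) : f = g := by
  refine LinearMap.ext fun x => ?_
  obtain ⟨t, rfl⟩ := Submodule.Quotient.mk_surjective _ x
  induction t using TensorProduct.induction_on with
  | zero => exact (map_zero f).trans (map_zero g).symm
  | tmul b m => exact h b m
  | add s t hs ht => rw [Submodule.Quotient.mk_add, map_add, map_add, hs, ht]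

/-- The functor `B ⊗_A - : Gr A ⥤ Gr B` for a homomorphism `φ : A → B` of graded algebras. -/
def baseChange [GradedAlgebra 𝒜] [GradedAlgebra ℬ] (φ : A →ₐ[k] B)
    (hφ : ∀ j, ∀ a ∈ 𝒜 j, φ a ∈ ℬ j) : GrMod 𝒜 ⥤ GrMod ℬ where
  obj M := baseChangeObj φ hφ M
  map f :=
    { toLin := tensorMap φ f.toLin
      map_deg := fun ht => tensorMap_mem φ f ht }
  map_id _ := hom_ext (tensor_hom_ext φ fun _ _ => rfl)
  map_comp _ _ := hom_ext (tensor_hom_ext φ fun _ _ => rfl)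

end BaseChange

end GrMod

/-- The functor `i* = L ⊗_R - : Gr R ⥤ Gr L`. -/
def leavittTensor (k : Type u) [Field k] (n : ℕ) :
    GrMod (freeGrading k n) ⥤ GrMod (leavittGrading k n) :=
  GrMod.baseChange (freeToLeavitt k n) (freeToLeavitt_mem k n)

end

end NCProj

open NCProj

/-! Everything rests on the identity `∑ w* w = 1`, the sum being over all words `w` of a fixed
length `s`; it is the relation `∑ xᵢ* xᵢ = 1` iterated. Call an element of an `R`-module torsion if
all long words kill it.

The quotient category. The identity shows that `1 ⊗ m = 0` in `L ⊗_R M` when `m` is torsion. For the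
converse, `L` is made to act on germs of functions on words: `m` gives the germ of `w ↦ w m`, this
assignment is compatible with `R → L`, and the germ vanishes only for torsion `m`
(`tmk_one_eq_zero_iff`). Moreover, long words carry any element of `L ⊗_R M` into the image of `M`
(`exists_wordR_smul_eq_tmk_one`), since each `xⱼ*` is cancelled by one letter. These two facts
replace flatness: `L ⊗ f` is injective, or surjective, exactly when the kernel, or cokernel, of `f`
is torsion. A graded module is torsion exactly when it lies in `Fdim` (`fdim_iff_isTorsionElt`), so
the morphisms inverted in forming `QGr R` are precisely those that `L ⊗_R -` inverts. Since `R → L`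
is an epimorphism of rings, restriction of scalars is fully faithful
(`Leavitt.map_smul_of_map_x_smul`); hence its left adjoint `L ⊗_R -` is a localization at the
morphisms it inverts.

Strong grading. It suffices that `1 ∈ Lᵢ L₋ᵢ`. The relations `x₀ x₀* = 1` and `∑ xᵢ* xᵢ = 1` give
this for `i = 1` and `i = -1`, and these cases can be nested.

Modules over `L₀`. This is Dade's theorem: over such a grading an element `m` is determined by the
function `b ↦ (b m)₀`, which yields faithfulness and fullness of `M ↦ M₀`; the module `A ⊗_{A₀} V`
has degree-zero component `V`, which yields essential surjectivity.

The algebra `L₀`. The map `a ↦ (x_p a x_q*)` identifies `L` with the matrices over `L`, so `Mₙ₊₁(k)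
⊗ L ≅ L`, and by iteration `Sᵢ ⊗ L ≅ L`. Restricting to `Sᵢ ⊗ 1` embeds `Sᵢ` in `L₀` compatibly with
the transition maps. The images exhaust `L₀` because it is spanned by the `w* v` with `w` and `v` of
equal length. -/

namespace NCProj

noncomputable section

/-! ### The universal property of extension of scalars -/

namespace GrMod

section TensorLift

variable {k A B : Type u} [Field k] [Ring A] [Algebra k A] [Ring B] [Algebra k B]

/-- A semilinear map `M → P` along `φ : A → B` induces a `B`-linear map `B ⊗_A M → P`. -/
def tensorLift (φ : A →ₐ[k] B) {M P : Type u} [AddCommGroup M] [Module A M] [AddCommGroup P]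
    [Module B P] (g : M →+ P) (hg : ∀ (a : A) (m : M), g (a • m) = φ a • g m) :
    Tensor φ M →ₗ[B] P :=
  Submodule.liftQ (tensorRel φ M)
    (TensorProduct.AlgebraTensorModule.lift
      (LinearMap.toSpanSingleton B (M →ₗ[ℤ] P) g.toIntLinearMap))
    (Submodule.span_le.2 (by
      rintro _ ⟨b, a, m, rfl⟩
      simp [hg, mul_smul]))

theorem tensorLift_tmk (φ : A →ₐ[k] B) {M P : Type u} [AddCommGroup M] [Module A M]
    [AddCommGroup P] [Module B P] (g : M →+ P) (hg : ∀ (a : A) (m : M), g (a • m) = φ a • g m)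
    (b : B) (m : M) : tensorLift φ g hg (tmk φ b m) = b • g m := rfl

theorem tmk_add (φ : A →ₐ[k] B) {M : Type u} [AddCommGroup M] [Module A M] (b : B) (m m' : M) :
    tmk φ b (m + m') = tmk φ b m + tmk φ b m' := by
  unfold tmk; rw [TensorProduct.tmul_add, map_add]

theorem tmk_zero (φ : A →ₐ[k] B) {M : Type u} [AddCommGroup M] [Module A M] (b : B) :
    tmk φ b (0 : M) = 0 := by
  unfold tmk; rw [TensorProduct.tmul_zero, map_zero]

theorem tensor_induction (φ : A →ₐ[k] B) {M : Type u} [AddCommGroup M] [Module A M]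
    {motive : Tensor φ M → Prop} (tmk : ∀ b m, motive (tmk φ b m))
    (add : ∀ s t, motive s → motive t → motive (s + t)) (t : Tensor φ M) : motive t := by
  obtain ⟨t, rfl⟩ := Submodule.Quotient.mk_surjective _ t
  induction t using TensorProduct.induction_on with
  | zero => simpa using tmk_zero (M := M) φ (0 : B) ▸ tmk 0 0
  | tmul b m => exact tmk b m
  | add s t hs ht => exact add _ _ hs ht

end TensorLift

end GrMod

/-! ### Words in the free algebra -/

section Words

variable (k : Type u) [Field k] {n : ℕ}

/-- The monomial of the free algebra whose letters, read from right to left, are those of `l`. -/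
def wordR (l : List (Fin (n + 1))) : FreeAlg k n := (l.map (FreeAlgebra.ι k)).reverse.prod

@[simp]
theorem wordR_nil : wordR k ([] : List (Fin (n + 1))) = 1 := rfl

/-- Words act on modules with their first letter applied first. This is the reason for the reversal:
`f ↦ (l ↦ f (i :: l))` then describes the action of `xᵢ` on `l ↦ wordR k l • m`. -/
theorem wordR_cons (i : Fin (n + 1)) (l : List (Fin (n + 1))) :
    wordR k (i :: l) = wordR k l * FreeAlgebra.ι k i := by
  simp [wordR]

theorem wordR_append (l l' : List (Fin (n + 1))) :
    wordR k (l ++ l') = wordR k l' * wordR k l := by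
  simp [wordR]

theorem wordR_mem (l : List (Fin (n + 1))) : wordR k l ∈ freeGrading k n l.length := by
  refine Submodule.subset_span ⟨l.reverse, ?_, ?_⟩
  · simp
  · simp [wordR]

variable {k}

/-- An element of a module over the free algebra is torsion if it is killed by all monomials of
large degree. -/
def IsTorsionElt (k : Type u) [Field k] (n : ℕ) {M : Type*} [AddCommGroup M]
    [Module (FreeAlg k n) M] (m : M) : Prop :=
  ∃ s : ℕ, ∀ l : List (Fin (n + 1)), s ≤ l.length → wordR k l • m = 0

/-- There are finitely many words of length `s`, so the bounds belonging to the elements `wordR k l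
• m` have a common upper bound. -/
theorem isTorsionElt_of_wordR_smul {M : Type*} [AddCommGroup M] [Module (FreeAlg k n) M] {m : M}
    (s : ℕ) (h : ∀ l : List (Fin (n + 1)), l.length = s → IsTorsionElt k n (wordR k l • m)) :
    IsTorsionElt k n m := by
  classical
  choose! r hr using h
  have hfin : {l : List (Fin (n + 1)) | l.length = s}.Finite := List.finite_length_eq _ s
  obtain ⟨b, hb⟩ := (hfin.image r).bddAbove
  refine ⟨s + b, fun l hl => ?_⟩
  have hl' : (l.take s).length = s := by simp; omega
  rw [← List.take_append_drop s l, wordR_append, mul_smul]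
  refine hr _ hl' _ ((hb ⟨_, hl', rfl⟩).trans ?_)
  simp; omega

theorem IsTorsionElt.add {M : Type*} [AddCommGroup M] [Module (FreeAlg k n) M] {m m' : M}
    (h : IsTorsionElt k n m) (h' : IsTorsionElt k n m') : IsTorsionElt k n (m + m') := by
  obtain ⟨s, hs⟩ := h
  obtain ⟨s', hs'⟩ := h'
  exact ⟨max s s', fun l hl => by
    rw [smul_add, hs l ((le_max_left _ _).trans hl), hs' l ((le_max_right _ _).trans hl),
      add_zero]⟩

end Words

/-! ### The module of germs over the Leavitt algebra -/

section Germs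

variable (k : Type u) [Field k] (n : ℕ) (V : Type u) [AddCommGroup V] [Module k V]

/-- The functions on words that vanish on all long words. -/
def eventuallyZero : Submodule k (List (Fin (n + 1)) → V) where
  carrier := {f | ∃ s : ℕ, ∀ l, s ≤ l.length → f l = 0}
  zero_mem' := ⟨0, fun _ _ => rfl⟩
  add_mem' := by
    rintro f g ⟨s, hs⟩ ⟨t, ht⟩
    refine ⟨max s t, fun l hl => ?_⟩
    rw [Pi.add_apply, hs l ((le_max_left _ _).trans hl), ht l ((le_max_right _ _).trans hl),
      add_zero]
  smul_mem' := by
    rintro c f ⟨s, hs⟩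
    exact ⟨s, fun l hl => by rw [Pi.smul_apply, hs l hl, smul_zero]⟩

/-- Germs of functions on words, where functions that agree on all long words are identified. -/
def Germs : Type u := (List (Fin (n + 1)) → V) ⧸ eventuallyZero k n V

instance : AddCommGroup (Germs k n V) :=
  inferInstanceAs (AddCommGroup ((List (Fin (n + 1)) → V) ⧸ eventuallyZero k n V))

instance : Module k (Germs k n V) :=
  inferInstanceAs (Module k ((List (Fin (n + 1)) → V) ⧸ eventuallyZero k n V))

/-- The germ of a function. -/
def toGerm : (List (Fin (n + 1)) → V) →ₗ[k] Germs k n V := (eventuallyZero k n V).mkQ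

variable {V} in
theorem toGerm_eq_zero_iff (f : List (Fin (n + 1)) → V) :
    toGerm k n V f = 0 ↔ ∃ s : ℕ, ∀ l, s ≤ l.length → f l = 0 :=
  Submodule.Quotient.mk_eq_zero _

/-- The operator on functions by which `xᵢ` acts. -/
def shiftFun (i : Fin (n + 1)) : (List (Fin (n + 1)) → V) →ₗ[k] (List (Fin (n + 1)) → V) where
  toFun f l := f (i :: l)
  map_add' _ _ := rfl
  map_smul' _ _ := rfl

/-- The operator on functions by which `xᵢ*` acts. -/
def unshiftFun (i : Fin (n + 1)) : (List (Fin (n + 1)) → V) →ₗ[k] (List (Fin (n + 1)) → V) where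
  toFun f
    | [] => 0
    | j :: l => if j = i then f l else 0
  map_add' f g := by
    funext l
    cases l with
    | nil => simp
    | cons j l => by_cases h : j = i <;> simp [h]
  map_smul' c f := by
    funext l
    cases l with
    | nil => simp
    | cons j l => by_cases h : j = i <;> simp [h]

/-- The operator on germs by which `xᵢ` acts. -/
def shiftGerm (i : Fin (n + 1)) : Module.End k (Germs k n V) :=
  Submodule.mapQ _ _ (shiftFun k n V i) (by
    rintro f ⟨s, hs⟩
    exact ⟨s, fun l hl => hs _ (hl.trans (by simp))⟩)

/-- The operator on germs by which `xᵢ*` acts. -/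
def unshiftGerm (i : Fin (n + 1)) : Module.End k (Germs k n V) :=
  Submodule.mapQ _ _ (unshiftFun k n V i) (by
    rintro f ⟨s, hs⟩
    refine ⟨s + 1, fun l hl => ?_⟩
    cases l with
    | nil => rfl
    | cons j l =>
      change (if j = i then f l else 0) = 0
      rw [hs l (by simpa using hl), ite_self])

variable {V} in
theorem shiftGerm_toGerm (i : Fin (n + 1)) (f : List (Fin (n + 1)) → V) :
    shiftGerm k n V i (toGerm k n V f) = toGerm k n V (fun l => f (i :: l)) := rfl

variable {V} in
theorem unshiftGerm_toGerm (i : Fin (n + 1)) (f : List (Fin (n + 1)) → V) :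
    unshiftGerm k n V i (toGerm k n V f) = toGerm k n V (unshiftFun k n V i f) := rfl

/-- The action of the Leavitt algebra on germs. -/
def germRep : Leavitt k n →ₐ[k] Module.End k (Germs k n V) :=
  RingQuot.liftAlgHom k ⟨FreeAlgebra.lift k
    (Sum.elim (shiftGerm k n V) (unshiftGerm k n V)), by
    intro a b h
    refine LinearMap.ext fun x => ?_
    obtain ⟨f, rfl⟩ : ∃ f, toGerm k n V f = x := Submodule.Quotient.mk_surjective _ x
    cases h with
    | x_mul_xs_self i =>
      simp only [map_mul, FreeAlgebra.lift_ι_apply, map_one, Sum.elim_inl, Sum.elim_inr,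
        Module.End.mul_apply, Module.End.one_apply, unshiftGerm_toGerm, shiftGerm_toGerm]
      congr 1
      funext l
      simp [unshiftFun]
    | x_mul_xs_ne i j hij =>
      simp only [map_mul, FreeAlgebra.lift_ι_apply, map_zero, Sum.elim_inl, Sum.elim_inr,
        Module.End.mul_apply, LinearMap.zero_apply, unshiftGerm_toGerm, shiftGerm_toGerm]
      rw [toGerm_eq_zero_iff]
      exact ⟨0, fun l _ => by simp [unshiftFun, hij]⟩
    | sum_xs_mul_x =>
      simp only [map_sum, map_mul, FreeAlgebra.lift_ι_apply, map_one, Sum.elim_inl, Sum.elim_inr,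
        Module.End.mul_apply, Module.End.one_apply, LinearMap.sum_apply, unshiftGerm_toGerm,
        shiftGerm_toGerm]
      rw [← map_sum, ← sub_eq_zero, ← map_sub, toGerm_eq_zero_iff]
      -- On functions the relation fails exactly at the empty word, where every `xᵢ*` gives zero;
      -- this is why germs are needed.
      refine ⟨1, fun l hl => ?_⟩
      cases l with
      | nil => simp at hl
      | cons j l => simp [unshiftFun]⟩

theorem germRep_gen (s : Fin (n + 1) ⊕ Fin (n + 1)) :
    germRep k n V (Leavitt.gen k n s) = Sum.elim (shiftGerm k n V) (unshiftGerm k n V) s := by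
  unfold germRep Leavitt.gen
  refine (RingQuot.liftAlgHom_mkAlgHom_apply k _ _ _).trans ?_
  exact FreeAlgebra.lift_ι_apply _ _

instance : Module (Leavitt k n) (Germs k n V) :=
  Module.compHom (Germs k n V) (germRep k n V).toRingHom

theorem leavitt_smul_germ (b : Leavitt k n) (x : Germs k n V) : b • x = germRep k n V b x := rfl

/-- A constant nonzero function has a nonzero germ, because words of every length exist. This is
what later makes `Sᵢ → L₀` injective. -/
instance : Nontrivial (Leavitt k n) := by
  refine nontrivial_of_ne 1 0 fun h => ?_
  have h1 : toGerm k n k (fun _ => 1) = 0 := by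
    rw [← one_smul (Leavitt k n) (toGerm k n k _), h, zero_smul]
  obtain ⟨s, hs⟩ := (toGerm_eq_zero_iff k n _).1 h1
  exact one_ne_zero (hs (List.replicate s 0) (by simp))

end Germs

/-! ### Torsion and the tensor product with the Leavitt algebra -/

section Torsion

variable {k : Type u} [Field k] {n : ℕ}

theorem freeToLeavitt_ι (i : Fin (n + 1)) :
    freeToLeavitt k n (FreeAlgebra.ι k i) = Leavitt.gen k n (Sum.inl i) :=
  FreeAlgebra.lift_ι_apply _ _

theorem Leavitt.x_mul_xs (i j : Fin (n + 1)) :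
    Leavitt.gen k n (Sum.inl i) * Leavitt.gen k n (Sum.inr j) = if i = j then 1 else 0 := by
  split_ifs with h
  · rw [h, Leavitt.x_mul_xs_self]
  · exact Leavitt.x_mul_xs_ne k n i j h

/-- The germ of `l ↦ wordR k l • m` depends semilinearly on `m`, so it factors through `L ⊗_R M` and
vanishes with `1 ⊗ m`. A vanishing germ is the definition of torsion. -/
theorem isTorsionElt_of_tmk_one_eq_zero {M : Type u} [AddCommGroup M] [Module (FreeAlg k n) M]
    {m : M} (h : GrMod.tmk (freeToLeavitt k n) 1 m = 0) : IsTorsionElt k n m := by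
  let _ : Module k M := Module.compHom M (algebraMap k (FreeAlg k n))
  let g : M →+ Germs k n M :=
    (toGerm k n M).toAddMonoidHom.comp
      (AddMonoidHom.mk' (fun m l => wordR k l • m) fun a b => by
        funext l; exact smul_add _ _ _)
  have hg : ∀ (a : FreeAlg k n) (m : M), g (a • m) = freeToLeavitt k n a • g m := by
    intro a
    induction a using FreeAlgebra.induction with
    | grade0 c =>
      intro m
      rw [AlgHom.commutes, leavitt_smul_germ, AlgHom.commutes, Module.algebraMap_end_apply]
      refine Eq.trans ?_ (map_smul (toGerm k n M) c _)
      refine congrArg (toGerm k n M) (funext fun l => ?_)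
      change wordR k l • algebraMap k (FreeAlg k n) c • m =
        algebraMap k (FreeAlg k n) c • wordR k l • m
      rw [← mul_smul, ← mul_smul, Algebra.commutes]
    | grade1 i =>
      intro m
      rw [freeToLeavitt_ι, leavitt_smul_germ, germRep_gen]
      refine congrArg (toGerm k n M) (funext fun l => ?_)
      change wordR k l • FreeAlgebra.ι k i • m = wordR k (i :: l) • m
      rw [wordR_cons, mul_smul]
    | mul a b ha hb => intro m; rw [mul_smul, ha, hb, map_mul, mul_smul]
    | add a b ha hb => intro m; rw [add_smul, map_add, ha, hb, map_add, add_smul]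
  have h0 : g m = 0 := by
    rw [← one_smul (Leavitt k n) (g m), ← GrMod.tensorLift_tmk (freeToLeavitt k n) g hg, h,
      map_zero]
  exact (toGerm_eq_zero_iff k n _).1 h0

/-- `t = ∑ w* (w t)` over the words of length `s`. It is applied with `p = ⊥` to prove vanishing and
with `p` the range of a map to prove surjectivity. -/
theorem Leavitt.mem_of_wordR_smul_mem {P : Type*} [AddCommGroup P] [Module (Leavitt k n) P]
    (p : Submodule (Leavitt k n) P) (s : ℕ) (t : P)
    (h : ∀ l : List (Fin (n + 1)), l.length = s → freeToLeavitt k n (wordR k l) • t ∈ p) :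
    t ∈ p := by
  induction s generalizing t with
  | zero => simpa using h [] rfl
  | succ s ih =>
    rw [← one_smul (Leavitt k n) t, ← Leavitt.sum_xs_mul_x, Finset.sum_smul]
    refine Submodule.sum_mem _ fun i _ => ?_
    rw [mul_smul]
    refine p.smul_mem _ (ih _ fun l hl => ?_)
    rw [← mul_smul, ← freeToLeavitt_ι, ← map_mul, ← wordR_cons]
    exact h _ (by simp [hl])

theorem tmk_one_eq_zero_iff {M : Type u} [AddCommGroup M] [Module (FreeAlg k n) M] {m : M} :
    GrMod.tmk (freeToLeavitt k n) 1 m = 0 ↔ IsTorsionElt k n m := by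
  refine ⟨isTorsionElt_of_tmk_one_eq_zero, fun ⟨s, hs⟩ => ?_⟩
  rw [← Submodule.mem_bot (Leavitt k n)]
  refine Leavitt.mem_of_wordR_smul_mem ⊥ s _ fun l hl => ?_
  rw [GrMod.smul_tmk, mul_one, ← one_mul (freeToLeavitt k n _), GrMod.tmk_mul, hs l hl.ge,
    GrMod.tmk_zero]
  exact Submodule.zero_mem _

/-- The projection from the free algebra onto the Leavitt algebra. -/
def Leavitt.mk (k : Type u) [Field k] (n : ℕ) :
    FreeAlgebra k (Fin (n + 1) ⊕ Fin (n + 1)) →ₐ[k] Leavitt k n :=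
  RingQuot.mkAlgHom k (LeavittRel k n)

theorem Leavitt.left_induction {p : Submodule k (Leavitt k n)} (one : 1 ∈ p)
    (gen_mul : ∀ s, ∀ b ∈ p, Leavitt.gen k n s * b ∈ p) (b : Leavitt k n) : b ∈ p := by
  have key : ∀ a : FreeAlgebra k (Fin (n + 1) ⊕ Fin (n + 1)), ∀ b ∈ p,
      Leavitt.mk k n a * b ∈ p := by
    intro a
    induction a using FreeAlgebra.induction with
    | grade0 c =>
      intro b hb
      rw [AlgHom.commutes]
      exact Algebra.smul_def c b ▸ p.smul_mem c hb
    | grade1 i => exact gen_mul i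
    | mul a b ha hb => intro c hc; rw [map_mul, mul_assoc]; exact ha _ (hb _ hc)
    | add a b ha hb =>
      intro c hc; rw [map_add, add_mul]; exact p.add_mem (ha _ hc) (hb _ hc)
  obtain ⟨a, rfl⟩ := RingQuot.mkAlgHom_surjective k (LeavittRel k n) b
  exact mul_one (Leavitt.mk k n a) ▸ key a 1 one

/-- Multiplying `b` on the left by `xⱼ*` costs one more letter, by `xᵢ xⱼ* = δᵢⱼ`; multiplying it by
`xᵢ` costs none. So the property passes through left multiplication by every generator. -/
theorem Leavitt.exists_wordR_mul_eq (b : Leavitt k n) :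
    ∃ s : ℕ, ∀ l : List (Fin (n + 1)), s ≤ l.length →
      ∃ a, freeToLeavitt k n (wordR k l) * b = freeToLeavitt k n a := by
  let p : Submodule k (Leavitt k n) :=
    { carrier := {b | ∃ s : ℕ, ∀ l : List (Fin (n + 1)), s ≤ l.length →
        freeToLeavitt k n (wordR k l) * b ∈ (freeToLeavitt k n).range}
      zero_mem' := ⟨0, fun l _ => by rw [mul_zero]; exact Subalgebra.zero_mem _⟩
      add_mem' := by
        rintro a b ⟨s, hs⟩ ⟨t, ht⟩
        refine ⟨max s t, fun l hl => ?_⟩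
        rw [mul_add]
        exact Subalgebra.add_mem _ (hs l ((le_max_left _ _).trans hl))
          (ht l ((le_max_right _ _).trans hl))
      smul_mem' := by
        rintro c b ⟨s, hs⟩
        refine ⟨s, fun l hl => ?_⟩
        rw [mul_smul_comm]
        exact Subalgebra.smul_mem _ (hs l hl) c }
  obtain ⟨s, hs⟩ : b ∈ p := by
    refine Leavitt.left_induction (p := p) ⟨0, fun l _ => by rw [mul_one]; exact ⟨_, rfl⟩⟩ ?_ b
    rintro (i | j) b ⟨s, hs⟩
    · refine ⟨s, fun l hl => ?_⟩
      rw [← mul_assoc, ← freeToLeavitt_ι, ← map_mul, ← wordR_cons]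
      exact hs _ (hl.trans (by simp))
    · refine ⟨s + 1, fun l hl => ?_⟩
      cases l with
      | nil => simp at hl
      | cons i l =>
        rw [wordR_cons, map_mul, freeToLeavitt_ι, mul_assoc, ← mul_assoc (Leavitt.gen k n _),
          Leavitt.x_mul_xs]
        split_ifs
        · rw [one_mul]; exact hs l (by simpa using hl)
        · rw [zero_mul, mul_zero]; exact Subalgebra.zero_mem _
  exact ⟨s, fun l hl => (hs l hl).imp fun _ h => h.symm⟩

theorem exists_wordR_smul_eq_tmk_one {M : Type u} [AddCommGroup M] [Module (FreeAlg k n) M]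
    (t : GrMod.Tensor (freeToLeavitt k n) M) :
    ∃ s : ℕ, ∀ l : List (Fin (n + 1)), s ≤ l.length →
      ∃ m, freeToLeavitt k n (wordR k l) • t = GrMod.tmk (freeToLeavitt k n) 1 m := by
  induction t using GrMod.tensor_induction with
  | tmk b m =>
    obtain ⟨s, hs⟩ := Leavitt.exists_wordR_mul_eq b
    refine ⟨s, fun l hl => ?_⟩
    obtain ⟨a, ha⟩ := hs l hl
    exact ⟨a • m, by rw [GrMod.smul_tmk, ha, ← GrMod.tmk_mul, one_mul]⟩
  | add t t' h h' =>
    obtain ⟨s, hs⟩ := h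
    obtain ⟨s', hs'⟩ := h'
    refine ⟨max s s', fun l hl => ?_⟩
    obtain ⟨m, hm⟩ := hs l ((le_max_left _ _).trans hl)
    obtain ⟨m', hm'⟩ := hs' l ((le_max_right _ _).trans hl)
    exact ⟨m + m', by rw [smul_add, hm, hm', GrMod.tmk_add]⟩

/-! ### Injectivity and surjectivity of `L ⊗ f` in terms of torsion -/

section TensorMap

variable {M N : Type u} [AddCommGroup M] [Module (FreeAlg k n) M] [AddCommGroup N]
  [Module (FreeAlg k n) N] (f : M →ₗ[FreeAlg k n] N)

theorem tensorMap_injective_iff :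
    Function.Injective (GrMod.tensorMap (freeToLeavitt k n) f) ↔
      ∀ m, f m = 0 → IsTorsionElt k n m := by
  constructor
  · intro h m hm
    rw [← tmk_one_eq_zero_iff]
    apply h
    rw [GrMod.tensorMap_tmk, hm, GrMod.tmk_zero, map_zero]
  · intro h
    rw [injective_iff_map_eq_zero]
    intro t ht
    obtain ⟨s, hs⟩ := exists_wordR_smul_eq_tmk_one t
    rw [← Submodule.mem_bot (Leavitt k n)]
    refine Leavitt.mem_of_wordR_smul_mem ⊥ s _ fun l hl => ?_
    obtain ⟨m, hm⟩ := hs l hl.ge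
    rw [hm, Submodule.mem_bot, tmk_one_eq_zero_iff]
    -- A long word turns `t` into some `1 ⊗ m`. Then `1 ⊗ f m = 0`, so `f m` is torsion, long words
    -- carry `m` into the kernel of `f`, and `m` itself is torsion.
    have hfm : IsTorsionElt k n (f m) := by
      rw [← tmk_one_eq_zero_iff, ← GrMod.tensorMap_tmk, ← hm, map_smul, ht, smul_zero]
    obtain ⟨r, hr⟩ := hfm
    refine isTorsionElt_of_wordR_smul r fun l hl => h _ ?_
    rw [map_smul, hr l hl.ge]

theorem tensorMap_surjective_iff :
    Function.Surjective (GrMod.tensorMap (freeToLeavitt k n) f) ↔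
      ∀ x : N ⧸ LinearMap.range f, IsTorsionElt k n x := by
  constructor
  · intro h x
    obtain ⟨y, rfl⟩ := Submodule.Quotient.mk_surjective _ x
    obtain ⟨t, ht⟩ := h (GrMod.tmk (freeToLeavitt k n) 1 y)
    rw [← tmk_one_eq_zero_iff]
    -- The composite `L ⊗ M → L ⊗ N → L ⊗ coker f` is zero, so surjectivity of the first map forces
    -- `1 ⊗ x = 0` for each class `x` in the cokernel.
    have hcomp : (GrMod.tensorMap (freeToLeavitt k n) (LinearMap.range f).mkQ).comp
        (GrMod.tensorMap (freeToLeavitt k n) f) = 0 := by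
      refine GrMod.tensor_hom_ext _ fun b m => ?_
      rw [LinearMap.comp_apply, GrMod.tensorMap_tmk, GrMod.tensorMap_tmk, LinearMap.zero_apply,
        ← GrMod.tmk_zero (freeToLeavitt k n) b]
      congr 1
      exact (Submodule.Quotient.mk_eq_zero _).2 ⟨m, rfl⟩
    have := LinearMap.congr_fun hcomp t
    rwa [LinearMap.comp_apply, ht] at this
  · intro h t
    rw [← LinearMap.mem_range]
    obtain ⟨s, hs⟩ := exists_wordR_smul_eq_tmk_one t
    refine Leavitt.mem_of_wordR_smul_mem _ s _ fun l hl => ?_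
    obtain ⟨y, hy⟩ := hs l hl.ge
    rw [hy]
    -- Two successive reductions by words: the first brings `t` to the form `1 ⊗ y`, the second
    -- brings `y` into the range of `f`.
    obtain ⟨r, hr⟩ := h (Submodule.Quotient.mk y)
    refine Leavitt.mem_of_wordR_smul_mem _ r _ fun l hl => ?_
    obtain ⟨m, hm⟩ := (Submodule.Quotient.mk_eq_zero (LinearMap.range f)).1
      ((Submodule.Quotient.mk_smul _ _ _).trans (hr l hl.ge))
    exact ⟨GrMod.tmk _ 1 m, by
      rw [GrMod.tensorMap_tmk, hm, GrMod.smul_tmk, mul_one, ← GrMod.tmk_mul, one_mul]⟩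

end TensorMap

end Torsion

/-! ### The grading of the Leavitt algebra is strong -/

section Strong

/-- `Aᵢ₊ⱼ = 1 · Aᵢ₊ⱼ ⊆ Aᵢ (A₋ᵢ Aᵢ₊ⱼ) ⊆ Aᵢ Aⱼ`. -/
theorem isStronglyGraded_of_one_mem {k A : Type u} [Field k] [Ring A] [Algebra k A]
    (𝒜 : ℤ → Submodule k A) [SetLike.GradedMonoid 𝒜] (h : ∀ i, (1 : A) ∈ 𝒜 i * 𝒜 (-i)) :
    IsStronglyGraded 𝒜 := by
  have hle : ∀ i j, 𝒜 i * 𝒜 j ≤ 𝒜 (i + j) := fun i j =>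
    Submodule.mul_le.2 fun a ha b hb => SetLike.mul_mem_graded ha hb
  intro i j
  refine le_antisymm (hle i j) ?_
  calc 𝒜 (i + j) = 1 * 𝒜 (i + j) := (one_mul _).symm
    _ ≤ (𝒜 i * 𝒜 (-i)) * 𝒜 (i + j) :=
      mul_le_mul_left (Submodule.one_le.2 (h i)) _
    _ = 𝒜 i * (𝒜 (-i) * 𝒜 (i + j)) := mul_assoc _ _ _
    _ ≤ 𝒜 i * 𝒜 j := by
      refine mul_le_mul_right ((hle _ _).trans (le_of_eq ?_)) _
      congr 1
      omega

theorem Leavitt.gen_mem (k : Type u) [Field k] (n : ℕ) (s : Fin (n + 1) ⊕ Fin (n + 1)) :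
    Leavitt.gen k n s ∈ leavittGrading k n (Leavitt.wt n s) :=
  gen_mem_wordGrading (Leavitt.gen k n) (Leavitt.wt n) s

theorem leavittGrading_one_mem (k : Type u) [Field k] (n : ℕ) (i : ℤ) :
    (1 : Leavitt k n) ∈ leavittGrading k n i * leavittGrading k n (-i) := by
  have hle : ∀ i j, leavittGrading k n i * leavittGrading k n j ≤ leavittGrading k n (i + j) :=
    fun i j => Submodule.mul_le.2 fun a ha b hb => SetLike.mul_mem_graded ha hb
  -- Insert `1 ∈ Lₑ L₋ₑ` in the middle of `Lᵢ L₋ᵢ`; the induction uses this with `e = 1` and `e =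
  -- -1`.
  have step : ∀ i e : ℤ, (1 : Leavitt k n) ∈ leavittGrading k n e * leavittGrading k n (-e) →
      (1 : Leavitt k n) ∈ leavittGrading k n i * leavittGrading k n (-i) →
      (1 : Leavitt k n) ∈ leavittGrading k n (i + e) * leavittGrading k n (-(i + e)) := by
    intro i e he hi
    rw [← Submodule.one_le] at he hi ⊢
    calc (1 : Submodule k (Leavitt k n))
        ≤ leavittGrading k n i * leavittGrading k n (-i) := hi
      _ = leavittGrading k n i * (1 * leavittGrading k n (-i)) := by rw [one_mul]
      _ ≤ leavittGrading k n i *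
          ((leavittGrading k n e * leavittGrading k n (-e)) * leavittGrading k n (-i)) :=
        mul_le_mul_right (mul_le_mul_left he _) _
      _ = (leavittGrading k n i * leavittGrading k n e) *
          (leavittGrading k n (-e) * leavittGrading k n (-i)) := by simp only [mul_assoc]
      _ ≤ leavittGrading k n (i + e) * leavittGrading k n (-(i + e)) := by
        refine mul_le_mul' (hle _ _) ((hle _ _).trans (le_of_eq ?_))
        congr 1
        omega
  have hpos : (1 : Leavitt k n) ∈ leavittGrading k n 1 * leavittGrading k n (-1) := by
    rw [← Leavitt.x_mul_xs_self k n 0]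
    exact Submodule.mul_mem_mul (Leavitt.gen_mem k n (Sum.inl 0)) (Leavitt.gen_mem k n (Sum.inr 0))
  have hneg : (1 : Leavitt k n) ∈ leavittGrading k n (-1) * leavittGrading k n (- -1) := by
    rw [← Leavitt.sum_xs_mul_x k n, neg_neg]
    exact Submodule.sum_mem _ fun i _ =>
      Submodule.mul_mem_mul (Leavitt.gen_mem k n (Sum.inr i)) (Leavitt.gen_mem k n (Sum.inl i))
  induction i using Int.induction_on with
  | zero =>
    have h := Submodule.mul_mem_mul (SetLike.one_mem_graded (leavittGrading k n))
      (SetLike.one_mem_graded (leavittGrading k n))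
    rwa [mul_one] at h
  | succ i ih => exact step _ _ hpos ih
  | pred i ih => exact step _ _ hneg ih

theorem leavittGrading_isStronglyGraded (k : Type u) [Field k] (n : ℕ) :
    IsStronglyGraded (leavittGrading k n) :=
  isStronglyGraded_of_one_mem _ (leavittGrading_one_mem k n)

end Strong

/-! ### Modules over strongly graded algebras -/

namespace GrMod

section Dade

variable {k A : Type u} [Field k] [Ring A] [Algebra k A] {𝒜 : ℤ → Submodule k A}

/-- The projection of a graded module onto its component of degree zero. -/
def projZero (M : GrMod 𝒜) : M.carrier →+ M.deg 0 :=
  AddMonoidHom.mk' (fun m => DirectSum.decompose M.deg m 0) fun a b => by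
    rw [DirectSum.decompose_add, DirectSum.add_apply]

theorem projZero_of_mem {M : GrMod 𝒜} {m : M.carrier} (hm : m ∈ M.deg 0) :
    projZero M m = ⟨m, hm⟩ :=
  Subtype.ext (DirectSum.decompose_of_mem_same _ hm)

theorem projZero_of_mem_ne {M : GrMod 𝒜} {m : M.carrier} {i : ℤ} (hm : m ∈ M.deg i)
    (hi : i ≠ 0) : projZero M m = 0 :=
  Subtype.ext (DirectSum.decompose_of_mem_ne _ hm hi)

theorem coe_projZero_smul {M : GrMod 𝒜} {i : ℤ} {b : A} (hb : b ∈ 𝒜 (-i)) (m : M.carrier) :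
    (projZero M (b • m) : M.carrier) = b • (DirectSum.decompose M.deg m i : M.carrier) := by
  induction m using DirectSum.Decomposition.inductionOn M.deg with
  | zero => simp
  | add m m' h h' =>
    rw [smul_add, map_add, AddSubgroup.coe_add, h, h', DirectSum.decompose_add,
      DirectSum.add_apply, AddSubgroup.coe_add, smul_add]
  | @homogeneous j m =>
    have hbm := M.smul_mem hb m.2
    by_cases h : j = i
    · subst h
      rw [neg_add_cancel] at hbm
      rw [projZero_of_mem hbm, DirectSum.decompose_of_mem_same _ m.2]
    · rw [projZero_of_mem_ne hbm (by omega), DirectSum.decompose_of_mem_ne _ m.2 h, smul_zero]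
      rfl

theorem smul_eq_zero_of_mem_mul {M : GrMod 𝒜} {i j : ℤ} {m : M.carrier}
    (h : ∀ b ∈ 𝒜 j, b • m = 0) {c : A} (hc : c ∈ 𝒜 i * 𝒜 j) : c • m = 0 := by
  induction hc using Submodule.mul_induction_on' with
  | mem_mul_mem a ha b hb => rw [mul_smul, h b hb, smul_zero]
  | add a _ b _ ha hb => rw [add_smul, ha, hb, add_zero]

/-- For `b` of degree `-i` the hypothesis says `b mᵢ = 0`. Hence `A₋ᵢ` kills `mᵢ`, and so does `1 ∈
Aᵢ A₋ᵢ`. -/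
theorem eq_zero_of_projZero_smul (h1 : ∀ i, (1 : A) ∈ 𝒜 i * 𝒜 (-i)) {M : GrMod 𝒜}
    {m : M.carrier} (h : ∀ b : A, projZero M (b • m) = 0) : m = 0 := by
  refine (DirectSum.decompose M.deg).injective (DFinsupp.ext fun i => Subtype.ext ?_)
  rw [DirectSum.decompose_zero, DirectSum.zero_apply, AddSubgroup.coe_zero,
    ← one_smul A (DirectSum.decompose M.deg m i : M.carrier)]
  refine smul_eq_zero_of_mem_mul (fun b hb => ?_) (h1 i)
  rw [← coe_projZero_smul hb, h, AddSubgroup.coe_zero]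

theorem eq_of_projZero_smul (h1 : ∀ i, (1 : A) ∈ 𝒜 i * 𝒜 (-i)) {M : GrMod 𝒜}
    {m m' : M.carrier} (h : ∀ b : A, projZero M (b • m) = projZero M (b • m')) : m = m' := by
  rw [← sub_eq_zero]
  exact eq_zero_of_projZero_smul h1 fun b => by rw [smul_sub, map_sub, h, sub_self]

variable [GradedAlgebra 𝒜]

/-- The element `y` is the value at `m` of the extension of `g`, characterized by its functions `b ↦
(b y)₀`. Writing `1 = ∑ a b'` with `a ∈ Aᵢ` and `b' ∈ A₋ᵢ`, one takes `y = ∑ a g(b' m)`. -/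
theorem exists_of_degZero_hom_homogeneous (h1 : ∀ i, (1 : A) ∈ 𝒜 i * 𝒜 (-i)) {M N : GrMod 𝒜}
    (g : M.deg 0 →ₗ[𝒜 0] N.deg 0) {i : ℤ} {m : M.carrier} (hm : m ∈ M.deg i) :
    ∃ y ∈ N.deg i, ∀ b : A, projZero N (b • y) = g (projZero M (b • m)) := by
  -- With `1` replaced by an arbitrary `c` in `Aᵢ A₋ᵢ`, and `m` by `c m`, the claim is additive in
  -- `c` and can be proved on products.
  have key : ∀ c ∈ 𝒜 i * 𝒜 (-i),
      ∃ y ∈ N.deg i, ∀ b : A, projZero N (b • y) = g (projZero M (b • c • m)) := by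
    intro c hc
    induction hc using Submodule.mul_induction_on' with
    | mem_mul_mem a ha b' hb' =>
      have hb'm : b' • m ∈ M.deg 0 := by simpa using M.smul_mem hb' hm
      have hy : a • (g ⟨_, hb'm⟩ : N.carrier) ∈ N.deg i := by
        simpa using N.smul_mem ha (g ⟨_, hb'm⟩).2
      have hz : a • b' • m ∈ M.deg i := by simpa using M.smul_mem ha hb'm
      refine ⟨_, hy, fun b => ?_⟩
      rw [mul_smul]
      induction b using DirectSum.Decomposition.inductionOn 𝒜 with
      | zero => simp
      | add b b' h h' => rw [add_smul, map_add, h, h', add_smul, map_add, map_add]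
      | @homogeneous j b =>
        -- Only when the degrees cancel is `b a` in `A₀`, and then the linearity of `g` applies;
        -- otherwise both sides are zero.
        by_cases hj : j + i = 0
        · have hba : (b : A) * a ∈ 𝒜 0 := hj ▸ SetLike.mul_mem_graded b.2 ha
          rw [← mul_smul, ← mul_smul (b : A) a]
          have e1 : projZero N (((b : A) * a) • (g ⟨_, hb'm⟩ : N.carrier)) =
              (⟨_, hba⟩ : 𝒜 0) • g ⟨_, hb'm⟩ :=
            projZero_of_mem ((⟨_, hba⟩ : 𝒜 0) • g ⟨_, hb'm⟩ : N.deg 0).2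
          have e2 : projZero M (((b : A) * a) • b' • m) =
              (⟨_, hba⟩ : 𝒜 0) • (⟨_, hb'm⟩ : M.deg 0) :=
            projZero_of_mem ((⟨_, hba⟩ : 𝒜 0) • (⟨_, hb'm⟩ : M.deg 0)).2
          rw [e1, e2, map_smul]
        · rw [projZero_of_mem_ne (N.smul_mem b.2 hy) hj,
            projZero_of_mem_ne (M.smul_mem b.2 hz) hj, map_zero]
    | add c _ c' _ h h' =>
      obtain ⟨y, hy, h⟩ := h
      obtain ⟨y', hy', h'⟩ := h'
      exact ⟨y + y', add_mem hy hy', fun b => by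
        rw [smul_add, map_add, h, h', add_smul, smul_add, map_add, map_add]⟩
  simpa using key 1 (h1 i)

theorem exists_of_degZero_hom (h1 : ∀ i, (1 : A) ∈ 𝒜 i * 𝒜 (-i)) {M N : GrMod 𝒜}
    (g : M.deg 0 →ₗ[𝒜 0] N.deg 0) (m : M.carrier) :
    ∃ y, ∀ b : A, projZero N (b • y) = g (projZero M (b • m)) := by
  induction m using DirectSum.Decomposition.inductionOn M.deg with
  | zero => exact ⟨0, by simp⟩
  | add m m' h h' =>
    obtain ⟨y, h⟩ := h
    obtain ⟨y', h'⟩ := h'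
    exact ⟨y + y', fun b => by rw [smul_add, map_add, h, h', smul_add, map_add, map_add]⟩
  | homogeneous m =>
    obtain ⟨y, -, h⟩ := exists_of_degZero_hom_homogeneous h1 g m.2
    exact ⟨y, h⟩

/-- The chosen values `f m` are unique by `eq_of_projZero_smul`, so additivity, linearity, degree
and the restriction to degree zero can all be tested on the functions `b ↦ (b · )₀`. -/
theorem exists_hom_of_degZero_hom (h1 : ∀ i, (1 : A) ∈ 𝒜 i * 𝒜 (-i)) {M N : GrMod 𝒜}
    (g : M.deg 0 →ₗ[𝒜 0] N.deg 0) :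
    ∃ f : M ⟶ N, ∀ m : M.deg 0, f.toLin m = g m := by
  choose f hf using exists_of_degZero_hom h1 g
  refine ⟨⟨{ toFun := f, map_add' := fun m m' => ?_, map_smul' := fun a m => ?_ }, ?_⟩, ?_⟩
  · refine eq_of_projZero_smul h1 fun b => ?_
    rw [hf, smul_add, smul_add, map_add, map_add, map_add, hf, hf]
  · refine eq_of_projZero_smul h1 fun b => ?_
    rw [hf, RingHom.id_apply, ← mul_smul, ← mul_smul, hf]
  · intro i m hm
    obtain ⟨y, hy, h⟩ := exists_of_degZero_hom_homogeneous h1 g hm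
    have : f m = y := eq_of_projZero_smul h1 fun b => by rw [hf, h]
    change f m ∈ _
    rwa [this]
  · intro m
    refine eq_of_projZero_smul h1 fun b => ?_
    obtain ⟨y, hy, h⟩ := exists_of_degZero_hom_homogeneous h1 g m.2
    have e : f m = y := eq_of_projZero_smul h1 fun b => by rw [hf, h]
    have e1 := h 1
    rw [one_smul, one_smul, projZero_of_mem hy, projZero_of_mem m.2] at e1
    have e2 : y = (g m : N.carrier) := congrArg Subtype.val e1
    change projZero N (b • f m) = _
    rw [e, e2]

theorem degZero_faithful (h1 : ∀ i, (1 : A) ∈ 𝒜 i * 𝒜 (-i)) : (degZero 𝒜).Faithful where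
  map_injective {M N} f f' h := by
    have hz : ∀ m : M.deg 0, f.toLin m = f'.toLin m := fun m =>
      congrArg (fun g : (degZero 𝒜).obj M ⟶ (degZero 𝒜).obj N =>
        (show N.deg 0 from g.hom m).1) h
    refine hom_ext (LinearMap.ext fun m => eq_of_projZero_smul h1 fun b => Subtype.ext ?_)
    have hp : ∀ f : M ⟶ N, (projZero N (b • f.toLin m) : N.carrier) =
        f.toLin (projZero M (b • m)) := fun f => by
      rw [← map_smul]
      exact (map_decompose f (b • m) 0).symm
    rw [hp, hp, hz]

theorem degZero_full (h1 : ∀ i, (1 : A) ∈ 𝒜 i * 𝒜 (-i)) : (degZero 𝒜).Full where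
  map_surjective {M N} g := by
    obtain ⟨f, hf⟩ := exists_hom_of_degZero_hom h1 (M := M) (N := N) g.hom
    exact ⟨f, ModuleCat.hom_ext (LinearMap.ext fun m => Subtype.ext (hf m))⟩

end Dade

/-! ### Essential surjectivity of `M ↦ M₀` -/

section EssSurj

variable {k A : Type u} [Field k] [Ring A] [Algebra k A]

/-- The grading of an algebra that is concentrated in degree zero. -/
def trivialGrading (k A : Type u) [Field k] [Ring A] [Algebra k A] (i : ℤ) : Submodule k A :=
  if i = 0 then ⊤ else ⊥

theorem mem_trivialGrading_zero (a : A) : a ∈ trivialGrading k A 0 := by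
  simp [trivialGrading]

theorem eq_zero_of_mem_trivialGrading {i : ℤ} (hi : i ≠ 0) {a : A}
    (ha : a ∈ trivialGrading k A i) : a = 0 := by
  simpa [trivialGrading, hi] using ha

/-- The decomposition for a family that is everything in degree zero and zero in all other
degrees. -/
@[reducible]
def concentratedDecomposition {V σ : Type*} [AddCommGroup V] [SetLike σ V]
    [AddSubmonoidClass σ V] (ℳ : ℤ → σ) (h0 : ∀ v, v ∈ ℳ 0) (hne : ∀ i ≠ 0, ∀ v ∈ ℳ i, v = 0) :
    DirectSum.Decomposition ℳ :=
  DirectSum.Decomposition.ofAddHom ℳ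
    ((DirectSum.of (fun i => ℳ i) 0).comp ⟨⟨fun v => ⟨v, h0 v⟩, rfl⟩, fun _ _ => rfl⟩)
    (AddMonoidHom.ext fun v => DirectSum.coeAddMonoidHom_of ℳ 0 _)
    (DirectSum.addHom_ext fun i x => by
      rw [AddMonoidHom.comp_apply, DirectSum.coeAddMonoidHom_of]
      by_cases hi : i = 0
      · subst hi; rfl
      · obtain rfl : x = 0 := Subtype.ext (hne i hi x x.2)
        rw [map_zero]
        exact map_zero _)

instance : GradedAlgebra (trivialGrading k A) where
  one_mem := mem_trivialGrading_zero 1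
  mul_mem := by
    intro i j a b ha hb
    by_cases hi : i = 0
    · by_cases hj : j = 0
      · subst hi hj
        exact mem_trivialGrading_zero _
      · rw [eq_zero_of_mem_trivialGrading hj hb, mul_zero]
        exact Submodule.zero_mem _
    · rw [eq_zero_of_mem_trivialGrading hi ha, zero_mul]
      exact Submodule.zero_mem _
  toDecomposition := concentratedDecomposition _ mem_trivialGrading_zero
    fun _ hi _ => eq_zero_of_mem_trivialGrading hi

/-- A module over `A`, as a graded module concentrated in degree zero. -/
def concentrated (V : Type u) [AddCommGroup V] [Module A V] : GrMod (trivialGrading k A) where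
  carrier := V
  deg i := if i = 0 then ⊤ else ⊥
  isInternal := by
    let _ : DirectSum.Decomposition fun i : ℤ => if i = 0 then (⊤ : AddSubgroup V) else ⊥ :=
      concentratedDecomposition _ (by simp) (fun i hi v hv => by simpa [hi] using hv)
    exact DirectSum.Decomposition.isInternal _
  smul_mem := by
    intro i j a m ha hm
    by_cases hi : i = 0
    · by_cases hj : j = 0
      · subst hi hj
        simp
      · obtain rfl : m = 0 := by simpa [hj] using hm
        rw [smul_zero]
        exact AddSubgroup.zero_mem _
    · rw [eq_zero_of_mem_trivialGrading hi ha, zero_smul]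
      exact AddSubgroup.zero_mem _

variable (𝒜 : ℤ → Submodule k A) [GradedAlgebra 𝒜]

/-- The inclusion of the component of degree zero. -/
def degZeroVal : 𝒜 0 →ₐ[k] A where
  toFun := Subtype.val
  map_one' := rfl
  map_mul' _ _ := rfl
  map_zero' := rfl
  map_add' _ _ := rfl
  commutes' _ := rfl

theorem degZeroVal_mem (j : ℤ) (a : 𝒜 0) (ha : a ∈ trivialGrading k (𝒜 0) j) :
    degZeroVal 𝒜 a ∈ 𝒜 j := by
  by_cases hj : j = 0
  · subst hj; exact a.2
  · rw [eq_zero_of_mem_trivialGrading hj ha]; exact Submodule.zero_mem _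

/-- The map `v ↦ (a ↦ a₀ v)` into the additive maps `A → V`, on which `A` acts through right
multiplication on the argument, is `A₀`-semilinear. It therefore factors through `A ⊗_{A₀} V`, and
evaluation at `1` recovers `v`. -/
theorem tmk_degZeroVal_injective (V : Type u) [AddCommGroup V] [Module (𝒜 0) V] :
    Function.Injective (fun v : V => tmk (degZeroVal 𝒜) 1 v) := by
  let inst : Module A (A →+ V) :=
    { smul := fun c f => f.comp (AddMonoidHom.mulRight c)
      one_smul := fun f => AddMonoidHom.ext fun a => congrArg f (mul_one a)
      mul_smul := fun c d f => AddMonoidHom.ext fun a => congrArg f (mul_assoc a c d).symm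
      smul_zero := fun c => rfl
      smul_add := fun c f g => rfl
      add_smul := fun c d f => AddMonoidHom.ext fun a =>
        (congrArg f (mul_add a c d)).trans (map_add f _ _)
      zero_smul := fun f => AddMonoidHom.ext fun a =>
        (congrArg f (mul_zero a)).trans (map_zero f) }
  let g : V →+ A →+ V := AddMonoidHom.mk'
    (fun v => AddMonoidHom.mk' (fun a => DirectSum.decompose 𝒜 a 0 • v) fun a b => by
      rw [DirectSum.decompose_add, DirectSum.add_apply, add_smul])
    fun v w => AddMonoidHom.ext fun a => smul_add _ _ _
  have hg : ∀ (a : 𝒜 0) (v : V), g (a • v) = inst.smul (degZeroVal 𝒜 a) (g v) := by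
    intro a v
    refine AddMonoidHom.ext fun b => ?_
    change DirectSum.decompose 𝒜 b 0 • a • v = DirectSum.decompose 𝒜 (b * a) 0 • v
    rw [← mul_smul]
    congr 1
    refine Subtype.ext ?_
    have := DirectSum.coe_decompose_mul_add_of_right_mem 𝒜 (a := b) (i := 0) a.2
    rw [zero_add] at this
    exact this.symm
  intro v w h
  have h' : (1 : A) • g v = (1 : A) • g w := by
    rw [← tensorLift_tmk (degZeroVal 𝒜) g hg, ← tensorLift_tmk (degZeroVal 𝒜) g hg]
    exact congrArg _ h
  rw [one_smul, one_smul] at h'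
  have h2 := DFunLike.congr_fun h' 1
  change DirectSum.decompose 𝒜 (1 : A) 0 • v = DirectSum.decompose 𝒜 (1 : A) 0 • w at h2
  have h3 : DirectSum.decompose 𝒜 (1 : A) 0 = 1 :=
    Subtype.ext (DirectSum.decompose_of_mem_same 𝒜 (SetLike.one_mem_graded 𝒜))
  rwa [h3, one_smul, one_smul] at h2

/-- A preimage of `V` is `A ⊗_{A₀} V` with `V` placed in degree zero. This holds for every grading,
strong or not. -/
instance degZero_essSurj : (degZero 𝒜).EssSurj where
  mem_essImage V := by
    let W : GrMod (trivialGrading k (𝒜 0)) := concentrated V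
    let M : GrMod 𝒜 := baseChangeObj (degZeroVal 𝒜) (degZeroVal_mem 𝒜) W
    have hmem : ∀ v : V, tmk (degZeroVal 𝒜) 1 v ∈ M.deg 0 := fun v =>
      tmk_mem (degZeroVal 𝒜) W (p := 0) (q := 0) (m := v) (SetLike.one_mem_graded 𝒜)
        (by change v ∈ (if (0 : ℤ) = 0 then (⊤ : AddSubgroup V) else ⊥); simp)
    let f : V →ₗ[𝒜 0] M.deg 0 :=
      { toFun := fun v => ⟨tmk (degZeroVal 𝒜) 1 v, hmem v⟩
        map_add' := fun v w => Subtype.ext (tmk_add _ _ _ _)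
        map_smul' := fun a v => Subtype.ext ((tmk_mul (degZeroVal 𝒜) 1 a v).symm.trans (by
          change _ = (a : A) • tmk (degZeroVal 𝒜) 1 v
          rw [smul_tmk, one_mul, mul_one]; rfl)) }
    have hf : Function.Bijective f := by
      refine ⟨fun v w h => tmk_degZeroVal_injective 𝒜 V (congrArg Subtype.val h), ?_⟩
      rintro ⟨t, ht⟩
      suffices ∃ v : V, tmk (degZeroVal 𝒜) 1 v = t from
        this.imp fun v hv => Subtype.ext hv
      change t ∈ tensorDeg 𝒜 (degZeroVal 𝒜) W 0 at ht
      induction ht using AddSubgroup.closure_induction with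
      | mem t h =>
        obtain ⟨p, q, b, m, hb, hm, hj, rfl⟩ := h
        -- A nonzero `m` lies in degree zero, so `b` does too and moves across the tensor sign: `b ⊗
        -- m = 1 ⊗ b m`.
        by_cases hq : q = 0
        · obtain rfl : p = 0 := by omega
          refine ⟨(⟨b, hb⟩ : 𝒜 0) • (show V from m), ?_⟩
          refine (tmk_mul (degZeroVal 𝒜) 1 ⟨b, hb⟩ (show V from m)).symm.trans ?_
          rw [one_mul]
          rfl
        · obtain rfl : m = 0 := by
            change m ∈ (if q = 0 then (⊤ : AddSubgroup V) else ⊥) at hm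
            rw [if_neg hq] at hm
            exact (AddSubgroup.mem_bot (G := V)).1 hm
          exact ⟨0, (tmk_zero _ _).trans (tmk_zero _ _).symm⟩
      | zero => exact ⟨0, tmk_zero _ _⟩
      | add s t _ _ hs ht =>
        obtain ⟨v, rfl⟩ := hs
        obtain ⟨w, rfl⟩ := ht
        exact ⟨v + w, tmk_add _ _ _ _⟩
      | neg t _ ht =>
        obtain ⟨v, rfl⟩ := ht
        refine ⟨-v, eq_neg_of_add_eq_zero_left ?_⟩
        rw [← tmk_add, neg_add_cancel, tmk_zero]
    exact ⟨M, ⟨(LinearEquiv.ofBijective f hf).toModuleIso.symm⟩⟩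

end EssSurj

theorem degZero_isEquivalence {k A : Type u} [Field k] [Ring A] [Algebra k A]
    {𝒜 : ℤ → Submodule k A} [GradedAlgebra 𝒜] (h1 : ∀ i, (1 : A) ∈ 𝒜 i * 𝒜 (-i)) :
    (degZero 𝒜).IsEquivalence where
  faithful := degZero_faithful h1
  full := degZero_full h1
  essSurj := degZero_essSurj 𝒜

end GrMod

/-! ### The component of degree zero of the Leavitt algebra -/

section DegreeZeroComponent

variable (k : Type u) [Field k] (n : ℕ)

/-- The Leavitt algebra is isomorphic to the algebra of `(n + 1) × (n + 1)` matrices over it. -/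
def Leavitt.matrixEquiv : Matrix (Fin (n + 1)) (Fin (n + 1)) (Leavitt k n) ≃ₐ[k] Leavitt k n :=
  -- The direction `L → Mₙ₊₁(L)` is the one where multiplicativity is immediate: `∑ x_r* x_r = 1` is
  -- inserted between the two factors. The same identity on both sides gives the left inverse, and
  -- `x_p x_r* = δ_pr` gives the right inverse.
  AlgEquiv.symm <| AlgEquiv.ofLinearEquiv
    { toFun := fun a p q => Leavitt.gen k n (Sum.inl p) * a * Leavitt.gen k n (Sum.inr q)
      map_add' := fun a b => by
        ext p q; exact (congrArg (· * _) (mul_add _ a b)).trans (add_mul _ _ _)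
      map_smul' := fun c a => by
        ext p q; exact (congrArg (· * _) (mul_smul_comm c _ a)).trans (smul_mul_assoc c _ _)
      invFun := fun m => ∑ p, ∑ q, Leavitt.gen k n (Sum.inr p) * m p q * Leavitt.gen k n (Sum.inl q)
      left_inv := fun a => by
        have h : ∀ p q : Fin (n + 1), Leavitt.gen k n (Sum.inr p) *
            (Leavitt.gen k n (Sum.inl p) * a * Leavitt.gen k n (Sum.inr q)) *
            Leavitt.gen k n (Sum.inl q) =
            (Leavitt.gen k n (Sum.inr p) * Leavitt.gen k n (Sum.inl p)) * a *
            (Leavitt.gen k n (Sum.inr q) * Leavitt.gen k n (Sum.inl q)) := by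
          intro p q; simp only [mul_assoc]
        simp only [h, ← Finset.mul_sum, ← Finset.sum_mul, Leavitt.sum_xs_mul_x, one_mul, mul_one]
      right_inv := fun m => by
        ext p q
        have h : ∀ r s : Fin (n + 1), Leavitt.gen k n (Sum.inl p) *
            (Leavitt.gen k n (Sum.inr r) * m r s * Leavitt.gen k n (Sum.inl s)) *
            Leavitt.gen k n (Sum.inr q) =
            (Leavitt.gen k n (Sum.inl p) * Leavitt.gen k n (Sum.inr r)) * m r s *
            (Leavitt.gen k n (Sum.inl s) * Leavitt.gen k n (Sum.inr q)) := by
          intro r s; simp only [mul_assoc]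
        simp only [Finset.mul_sum, Finset.sum_mul, h, Leavitt.x_mul_xs]
        simp }
    (by
      ext p q
      change Leavitt.gen k n (Sum.inl p) * 1 * Leavitt.gen k n (Sum.inr q) = _
      rw [mul_one, Leavitt.x_mul_xs, Matrix.one_apply])
    (fun a b => by
      ext p q
      rw [Matrix.mul_apply]
      have h : ∀ r : Fin (n + 1),
          (Leavitt.gen k n (Sum.inl p) * a * Leavitt.gen k n (Sum.inr r)) *
          (Leavitt.gen k n (Sum.inl r) * b * Leavitt.gen k n (Sum.inr q)) =
          (Leavitt.gen k n (Sum.inl p) * a) *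
            (Leavitt.gen k n (Sum.inr r) * Leavitt.gen k n (Sum.inl r)) *
            (b * Leavitt.gen k n (Sum.inr q)) := by
        intro r; simp only [mul_assoc]
      change Leavitt.gen k n (Sum.inl p) * (a * b) * Leavitt.gen k n (Sum.inr q) =
        ∑ r, (Leavitt.gen k n (Sum.inl p) * a * Leavitt.gen k n (Sum.inr r)) *
          (Leavitt.gen k n (Sum.inl r) * b * Leavitt.gen k n (Sum.inr q))
      simp only [h, ← Finset.mul_sum, ← Finset.sum_mul, Leavitt.sum_xs_mul_x, mul_one]
      simp only [mul_assoc])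

theorem Leavitt.matrixEquiv_apply (m : Matrix (Fin (n + 1)) (Fin (n + 1)) (Leavitt k n)) :
    Leavitt.matrixEquiv k n m =
      ∑ p, ∑ q, Leavitt.gen k n (Sum.inr p) * m p q * Leavitt.gen k n (Sum.inl q) := rfl

/-- The isomorphism `Mₙ₊₁(k) ⊗ L ≅ L`. -/
def Leavitt.matrixTensorEquiv :
    Matrix (Fin (n + 1)) (Fin (n + 1)) k ⊗[k] Leavitt k n ≃ₐ[k] Leavitt k n :=
  (Algebra.TensorProduct.comm k _ _).trans
    ((matrixEquivTensor (Fin (n + 1)) k (Leavitt k n)).symm.trans (Leavitt.matrixEquiv k n))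

theorem Leavitt.matrixTensorEquiv_tmul (m : Matrix (Fin (n + 1)) (Fin (n + 1)) k)
    (z : Leavitt k n) :
    Leavitt.matrixTensorEquiv k n (m ⊗ₜ z) =
      ∑ p, ∑ q, m p q • (Leavitt.gen k n (Sum.inr p) * z * Leavitt.gen k n (Sum.inl q)) := by
  change Leavitt.matrixEquiv k n ((matrixEquivTensor (Fin (n + 1)) k (Leavitt k n)).symm
    (z ⊗ₜ m)) = _
  rw [matrixEquivTensor_apply_symm, Leavitt.matrixEquiv_apply]
  refine Finset.sum_congr rfl fun p _ => Finset.sum_congr rfl fun q _ => ?_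
  rw [Matrix.smul_apply, Matrix.map_apply, smul_eq_mul, ← Algebra.commutes, ← Algebra.smul_def,
    mul_smul_comm, smul_mul_assoc]

/-- The isomorphism `(M ⊗ S) ⊗ L ≅ S ⊗ (M ⊗ L) ≅ S ⊗ L ≅ L` that isomorphisms `M ⊗ L ≅ L` and
`S ⊗ L ≅ L` induce. -/
def tensorAbsorb {k M S L : Type u} [Field k] [Ring M] [Algebra k M] [Ring S] [Algebra k S]
    [Ring L] [Algebra k L] (d : M ⊗[k] L ≃ₐ[k] L) (e : S ⊗[k] L ≃ₐ[k] L) :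
    (M ⊗[k] S) ⊗[k] L ≃ₐ[k] L :=
  (Algebra.TensorProduct.assoc k k k M S L).trans
    ((Algebra.TensorProduct.leftComm k M S L).trans
      ((Algebra.TensorProduct.congr AlgEquiv.refl d).trans e))

theorem tensorAbsorb_tmul {k M S L : Type u} [Field k] [Ring M] [Algebra k M] [Ring S]
    [Algebra k S] [Ring L] [Algebra k L] (d : M ⊗[k] L ≃ₐ[k] L) (e : S ⊗[k] L ≃ₐ[k] L) (m : M)
    (a : S) (z : L) : tensorAbsorb d e ((m ⊗ₜ a) ⊗ₜ z) = e (a ⊗ₜ d (m ⊗ₜ z)) := rfl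

theorem tensorAbsorb_mem {k M S L : Type u} [Field k] [Ring M] [Algebra k M] [Ring S]
    [Algebra k S] [Ring L] [Algebra k L] (d : M ⊗[k] L ≃ₐ[k] L) (e : S ⊗[k] L ≃ₐ[k] L)
    (p : Submodule k L) (hd : ∀ m, ∀ z ∈ p, d (m ⊗ₜ z) ∈ p) (he : ∀ a, ∀ z ∈ p, e (a ⊗ₜ z) ∈ p)
    (a : M ⊗[k] S) (z : L) (hz : z ∈ p) : tensorAbsorb d e (a ⊗ₜ z) ∈ p := by
  induction a using TensorProduct.induction_on with
  | zero => rw [TensorProduct.zero_tmul, map_zero]; exact Submodule.zero_mem _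
  | tmul m a =>
    rw [tensorAbsorb_tmul]
    exact he _ _ (hd _ _ hz)
  | add a b ha hb => rw [TensorProduct.add_tmul, map_add]; exact Submodule.add_mem _ ha hb

theorem Leavitt.matrixTensorEquiv_mem (m : Matrix (Fin (n + 1)) (Fin (n + 1)) k)
    (z : Leavitt k n) (hz : z ∈ leavittGrading k n 0) :
    Leavitt.matrixTensorEquiv k n (m ⊗ₜ z) ∈ leavittGrading k n 0 := by
  rw [Leavitt.matrixTensorEquiv_tmul]
  refine Submodule.sum_mem _ fun p _ => Submodule.sum_mem _ fun q _ =>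
    Submodule.smul_mem _ _ ?_
  have h := SetLike.mul_mem_graded
    (SetLike.mul_mem_graded (Leavitt.gen_mem k n (Sum.inr p)) hz)
    (Leavitt.gen_mem k n (Sum.inl q))
  have hwt : Leavitt.wt n (Sum.inr p) + 0 + Leavitt.wt n (Sum.inl q) = 0 := by simp [Leavitt.wt]
  rwa [hwt] at h

/-- The isomorphism `Sᵢ ⊗ L ≅ L`. -/
def Leavitt.matPowTensorEquiv : (i : ℕ) → (matPow k n i ⊗[k] Leavitt k n ≃ₐ[k] Leavitt k n)
  | 0 => (Algebra.TensorProduct.lid k (Leavitt k n) : k ⊗[k] Leavitt k n ≃ₐ[k] Leavitt k n)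
  | i + 1 => tensorAbsorb (Leavitt.matrixTensorEquiv k n) (Leavitt.matPowTensorEquiv i)

theorem Leavitt.matPowTensorEquiv_mem (i : ℕ) (a : matPow k n i) (z : Leavitt k n)
    (hz : z ∈ leavittGrading k n 0) :
    Leavitt.matPowTensorEquiv k n i (a ⊗ₜ z) ∈ leavittGrading k n 0 := by
  induction i generalizing z with
  | zero =>
    have h : Leavitt.matPowTensorEquiv k n 0 (a ⊗ₜ z) = (show k from a) • z :=
      Algebra.TensorProduct.lid_tmul (show k from a) z
    rw [h]
    exact Submodule.smul_mem _ _ hz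
  | succ i ih =>
    exact tensorAbsorb_mem (Leavitt.matrixTensorEquiv k n)
      (Leavitt.matPowTensorEquiv k n i) _ (Leavitt.matrixTensorEquiv_mem k n) ih a z hz

/-- The homomorphism `Sᵢ → L₀`. -/
def Leavitt.ofMatPow (i : ℕ) : matPow k n i →ₐ[k] leavittGrading k n 0 where
  toFun a := ⟨Leavitt.matPowTensorEquiv k n i (a ⊗ₜ 1),
    Leavitt.matPowTensorEquiv_mem k n i a 1 (SetLike.one_mem_graded (leavittGrading k n))⟩
  map_one' := Subtype.ext (map_one (Leavitt.matPowTensorEquiv k n i))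
  map_mul' a b := Subtype.ext (by
    have h : (a * b) ⊗ₜ[k] (1 : Leavitt k n) = (a ⊗ₜ 1) * (b ⊗ₜ 1) := by simp
    exact (congrArg _ h).trans (map_mul (Leavitt.matPowTensorEquiv k n i) _ _))
  map_zero' := Subtype.ext (by
    have h : (0 : matPow k n i) ⊗ₜ[k] (1 : Leavitt k n) = 0 := TensorProduct.zero_tmul _ _
    exact (congrArg _ h).trans (map_zero (Leavitt.matPowTensorEquiv k n i)))
  map_add' a b := Subtype.ext (by
    have h : (a + b) ⊗ₜ[k] (1 : Leavitt k n) = (a ⊗ₜ 1) + (b ⊗ₜ 1) := TensorProduct.add_tmul _ _ _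
    exact (congrArg _ h).trans (map_add (Leavitt.matPowTensorEquiv k n i) _ _))
  commutes' c := Subtype.ext ((Leavitt.matPowTensorEquiv k n i).commutes c)

theorem Leavitt.coe_ofMatPow (i : ℕ) (a : matPow k n i) :
    (Leavitt.ofMatPow k n i a : Leavitt k n) = Leavitt.matPowTensorEquiv k n i (a ⊗ₜ 1) := rfl

theorem Leavitt.ofMatPow_injective (i : ℕ) : Function.Injective (Leavitt.ofMatPow k n i) := by
  intro a b h
  have h' := (Leavitt.matPowTensorEquiv k n i).injective (congrArg Subtype.val h)
  exact Algebra.TensorProduct.includeLeft_injective (R := k) (S := k) (A := matPow k n i)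
    (B := Leavitt k n) (algebraMap k (Leavitt k n)).injective h'

/-- `tensorAbsorb` lets the newest matrix factor act first, directly on the element of `L`. The new
factor is `1` and that element is `1`, so it leaves no trace. -/
theorem Leavitt.ofMatPow_matPowSucc (i : ℕ) (a : matPow k n i) :
    Leavitt.ofMatPow k n (i + 1) (matPowSucc k n i a) = Leavitt.ofMatPow k n i a := by
  refine Subtype.ext ?_
  rw [Leavitt.coe_ofMatPow, Leavitt.coe_ofMatPow]
  refine (tensorAbsorb_tmul (Leavitt.matrixTensorEquiv k n) (Leavitt.matPowTensorEquiv k n i)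
    1 a 1).trans ?_
  rw [← Algebra.TensorProduct.one_def, map_one]

theorem Leavitt.ofMatPow_matPowMap (i j : ℕ) (h : i ≤ j) (a : matPow k n i) :
    Leavitt.ofMatPow k n j (matPowMap k n i j h a) = Leavitt.ofMatPow k n i a := by
  induction h using Nat.leRec with
  | refl => simp [matPowMap]
  | le_succ_of_le h ih =>
    refine Eq.trans ?_ ((Leavitt.ofMatPow_matPowSucc k n _ _).trans ih)
    unfold matPowMap
    rw [Nat.leRec_succ _ _ h]
    rfl

/-- The homomorphism `S → L₀`. -/
def Leavitt.ofMatLimit : MatLimit k n →ₐ[k] leavittGrading k n 0 :=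
  AlgHom.ofLinearMap
    (DirectLimit.Module.lift k ℕ (fun i => matPow k n i) (fun i j h => matPowMap k n i j h)
      (fun i => (Leavitt.ofMatPow k n i).toLinearMap) (Leavitt.ofMatPow_matPowMap k n))
    (by
      rw [DirectLimit.one_def 0]
      exact map_one (Leavitt.ofMatPow k n 0))
    (by
      intro x y
      induction x, y using DirectLimit.induction₂ with
      | _ i x y =>
        rw [DirectLimit.mul_def]
        exact map_mul (Leavitt.ofMatPow k n i) x y)

theorem Leavitt.ofMatLimit_injective : Function.Injective (Leavitt.ofMatLimit k n) :=
  DirectLimit.lift_injective _ _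
    (fun i j h x => (Leavitt.ofMatPow_matPowMap k n i j h x).symm) (Leavitt.ofMatPow_injective k n)

/-- The monomial `w* v` of the Leavitt algebra, where the letters of `w` are read from left to
right in `w*` and those of `v` from right to left. -/
def Leavitt.monomial (w v : List (Fin (n + 1))) : Leavitt k n :=
  (w.map fun i => Leavitt.gen k n (Sum.inr i)).prod * freeToLeavitt k n (wordR k v)

/-- A letter `xᵢ*` put in front of `w* v` lengthens `w`. A letter `xᵢ` cancels the first letter of
`w` or gives zero, and it lengthens `v` if `w` is empty. Each case respects the weight. -/
theorem Leavitt.prod_gen_mem_span (l : List (Fin (n + 1) ⊕ Fin (n + 1))) :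
    (l.map (Leavitt.gen k n)).prod ∈ Submodule.span k
      {a | ∃ w v : List (Fin (n + 1)), (v.length : ℤ) - w.length = (l.map (Leavitt.wt n)).sum ∧
        Leavitt.monomial k n w v = a} := by
  induction l with
  | nil => exact Submodule.subset_span ⟨[], [], by simp, by simp [Leavitt.monomial]⟩
  | cons s l ih =>
    simp only [List.map_cons, List.prod_cons, List.sum_cons]
    -- Forgetting that `b` is a product of generators allows induction over the span.
    revert ih
    generalize (l.map (Leavitt.gen k n)).prod = b
    intro ih
    induction ih using Submodule.span_induction with
    | zero => rw [mul_zero]; exact Submodule.zero_mem _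
    | add a b _ _ ha hb => rw [mul_add]; exact Submodule.add_mem _ ha hb
    | smul c a _ ha => rw [mul_smul_comm]; exact Submodule.smul_mem _ _ ha
    | mem a h =>
      obtain ⟨w, v, hwv, rfl⟩ := h
      rw [← hwv]
      cases s with
      | inr i =>
        refine Submodule.subset_span ⟨i :: w, v, ?_, ?_⟩
        · simp [Leavitt.wt]; ring
        · simp [Leavitt.monomial, mul_assoc]
      | inl i =>
        cases w with
        | nil =>
          refine Submodule.subset_span ⟨[], v ++ [i], ?_, ?_⟩
          · simp [Leavitt.wt]; ring
          · simp [Leavitt.monomial, wordR_append, wordR_cons, freeToLeavitt_ι]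
        | cons j w =>
          simp only [Leavitt.monomial, List.map_cons, List.prod_cons]
          rw [mul_assoc (Leavitt.gen k n _), ← mul_assoc, Leavitt.x_mul_xs]
          split_ifs
          · rw [one_mul]
            refine Submodule.subset_span ⟨w, v, ?_, rfl⟩
            simp [Leavitt.wt]; ring
          · rw [zero_mul]; exact Submodule.zero_mem _

/-- The element `a` is a tensor product of matrix units. An arbitrary `z` is needed for the
induction, where `z` becomes `x_p* z x_q` for the innermost letters `p` and `q`, which are the last
ones of `w` and `v`. -/
theorem Leavitt.exists_matPowTensorEquiv_eq (i : ℕ) (w v : List (Fin (n + 1)))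
    (hw : w.length = i) (hv : v.length = i) :
    ∃ a : matPow k n i, ∀ z : Leavitt k n, Leavitt.matPowTensorEquiv k n i (a ⊗ₜ z) =
      (w.map fun i => Leavitt.gen k n (Sum.inr i)).prod * z * freeToLeavitt k n (wordR k v) := by
  induction i generalizing w v with
  | zero =>
    obtain rfl := List.length_eq_zero_iff.1 hw
    obtain rfl := List.length_eq_zero_iff.1 hv
    refine ⟨(1 : k), fun z => ?_⟩
    refine (Algebra.TensorProduct.lid_tmul (1 : k) z).trans ?_
    simp
  | succ i ih =>
    obtain rfl | ⟨w, p, rfl⟩ := List.eq_nil_or_concat w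
    · simp at hw
    obtain rfl | ⟨v, q, rfl⟩ := List.eq_nil_or_concat v
    · simp at hv
    obtain ⟨a, ha⟩ := ih w v (by simpa using hw) (by simpa using hv)
    refine ⟨(Matrix.single p q (1 : k)) ⊗ₜ[k] a, fun z => ?_⟩
    refine (tensorAbsorb_tmul (Leavitt.matrixTensorEquiv k n) (Leavitt.matPowTensorEquiv k n i)
      _ a z).trans ?_
    rw [Leavitt.matrixTensorEquiv_tmul, ha]
    have h : ∑ p', ∑ q', Matrix.single p q (1 : k) p' q' •
        (Leavitt.gen k n (Sum.inr p') * z * Leavitt.gen k n (Sum.inl q')) =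
        Leavitt.gen k n (Sum.inr p) * z * Leavitt.gen k n (Sum.inl q) := by
      rw [Finset.sum_eq_single p _ (by simp), Finset.sum_eq_single q _ (by simp)]
      · simp
      · intro q' _ hq'
        simp [hq'.symm]
      · intro p' _ hp'
        exact Finset.sum_eq_zero fun q' _ => by simp [hp'.symm]
    rw [h]
    simp [wordR_append, wordR_cons, freeToLeavitt_ι, mul_assoc]

theorem Leavitt.ofMatLimit_surjective : Function.Surjective (Leavitt.ofMatLimit k n) := by
  have hle : leavittGrading k n 0 ≤
      Submodule.map (Submodule.subtype (leavittGrading k n 0))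
        (LinearMap.range (Leavitt.ofMatLimit k n).toLinearMap) := by
    refine Submodule.span_le.2 ?_
    rintro _ ⟨l, hl, rfl⟩
    refine Submodule.span_le.2 ?_ (Leavitt.prod_gen_mem_span k n l)
    rintro _ ⟨w, v, hwv, rfl⟩
    rw [hl] at hwv
    -- Total weight zero forces `w` and `v` to have the same length, so `w* v` comes from one of the
    -- `Sᵢ`.
    obtain ⟨a, ha⟩ := Leavitt.exists_matPowTensorEquiv_eq k n v.length w v (by omega) rfl
    refine ⟨Leavitt.ofMatPow k n v.length a, ⟨⟦⟨v.length, a⟩⟧, rfl⟩, ?_⟩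
    refine (ha 1).trans ?_
    rw [mul_one, Leavitt.monomial]
  intro y
  obtain ⟨_, ⟨x, rfl⟩, hx⟩ := hle y.2
  exact ⟨x, Subtype.ext hx⟩

theorem leavittGrading_zero_algEquiv : Nonempty (leavittGrading k n 0 ≃ₐ[k] MatLimit k n) :=
  ⟨(AlgEquiv.ofBijective (Leavitt.ofMatLimit k n)
    ⟨Leavitt.ofMatLimit_injective k n, Leavitt.ofMatLimit_surjective k n⟩).symm⟩

end DegreeZeroComponent

/-! ### Restriction of scalars -/

namespace GrMod

section Restrict

variable {k A B : Type u} [Field k] [Ring A] [Algebra k A] [Ring B] [Algebra k B]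
  {𝒜 : ℤ → Submodule k A} {ℬ : ℤ → Submodule k B}

theorem isIso_iff_bijective {M N : GrMod 𝒜} (f : M ⟶ N) :
    IsIso f ↔ Function.Bijective f.toLin := by
  constructor
  · intro h
    have h1 : ∀ m, (inv f).toLin (f.toLin m) = m := fun m =>
      LinearMap.congr_fun (congrArg Hom.toLin (IsIso.hom_inv_id f)) m
    have h2 : ∀ m, f.toLin ((inv f).toLin m) = m := fun m =>
      LinearMap.congr_fun (congrArg Hom.toLin (IsIso.inv_hom_id f)) m
    exact ⟨Function.LeftInverse.injective h1, Function.RightInverse.surjective h2⟩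
  · intro h
    let e := LinearEquiv.ofBijective f.toLin h
    refine ⟨⟨⟨e.symm.toLinearMap, ?_⟩, ?_, ?_⟩⟩
    · intro i m hm
      obtain ⟨m, rfl⟩ := h.2 m
      have h1 : e.symm (f.toLin m) = m := e.symm_apply_apply m
      change e.symm (f.toLin m) ∈ _
      -- If `f m` has degree `i`, then `f mᵢ = (f m)ᵢ = f m`, and injectivity gives `m = mᵢ`.
      have h2 := map_decompose f m i
      rw [DirectSum.decompose_of_mem_same _ hm] at h2
      rw [h1, ← h.1 h2]
      exact (DirectSum.decompose M.deg m i).2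
    · exact hom_ext (LinearMap.ext fun m => e.symm_apply_apply m)
    · exact hom_ext (LinearMap.ext fun m => e.apply_symm_apply m)

theorem tensorLift_mem (φ : A →ₐ[k] B) {M : GrMod 𝒜} {N : GrMod ℬ} (g : M.carrier →+ N.carrier)
    (hg : ∀ (a : A) (m : M.carrier), g (a • m) = φ a • g m)
    (hdeg : ∀ i, ∀ m ∈ M.deg i, g m ∈ N.deg i) {i : ℤ} {t : Tensor φ M.carrier}
    (ht : t ∈ tensorDeg ℬ φ M i) : tensorLift φ g hg t ∈ N.deg i := by
  induction ht using AddSubgroup.closure_induction with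
  | mem t h =>
    obtain ⟨p, q, b, m, hb, hm, rfl, rfl⟩ := h
    exact N.smul_mem hb (hdeg _ _ hm)
  | zero => rw [map_zero]; exact AddSubgroup.zero_mem _
  | add s t _ _ hs ht => rw [map_add]; exact AddSubgroup.add_mem _ hs ht
  | neg t _ ht => rw [map_neg]; exact AddSubgroup.neg_mem _ ht

/-- The functor `Gr B ⥤ Gr A` that restricts scalars along `φ : A → B`. -/
def restrict (φ : A →ₐ[k] B) (hφ : ∀ j, ∀ a ∈ 𝒜 j, φ a ∈ ℬ j) : GrMod ℬ ⥤ GrMod 𝒜 where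
  obj N :=
    { carrier := N.carrier
      module := Module.compHom N.carrier φ.toRingHom
      deg := N.deg
      isInternal := N.isInternal
      smul_mem := fun ha hm => N.smul_mem (hφ _ _ ha) hm }
  map {N N'} f :=
    { toLin :=
        letI := Module.compHom N.carrier φ.toRingHom
        letI := Module.compHom N'.carrier φ.toRingHom
        { toFun := f.toLin
          map_add' := map_add f.toLin
          map_smul' := fun a m => map_smul f.toLin (φ a) m }
      map_deg := fun hm => f.map_deg hm }

variable [GradedAlgebra 𝒜] [GradedAlgebra ℬ]

/-- Homomorphisms `B ⊗_A M → N` correspond to homomorphisms from `M` to the restriction of `N`. -/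
def baseChangeHomEquiv (φ : A →ₐ[k] B) (hφ : ∀ j, ∀ a ∈ 𝒜 j, φ a ∈ ℬ j) (M : GrMod 𝒜)
    (N : GrMod ℬ) : ((baseChange φ hφ).obj M ⟶ N) ≃ (M ⟶ (restrict φ hφ).obj N) where
  toFun f :=
    { toLin :=
        { toFun := fun m => f.toLin (tmk φ 1 m)
          map_add' := fun m m' => (congrArg f.toLin (tmk_add φ 1 m m')).trans (map_add f.toLin _ _)
          map_smul' := fun a m => by
            rw [← tmk_mul, one_mul, ← mul_one (φ a), ← smul_tmk]
            exact map_smul f.toLin (φ a) (tmk φ 1 m) }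
      map_deg := fun {i m} hm => f.map_deg (by
        have h := tmk_mem (ℬ := ℬ) φ M (SetLike.one_mem_graded ℬ) hm
        rwa [zero_add] at h) }
  invFun g :=
    { toLin := tensorLift (P := N.carrier) φ g.toLin.toAddMonoidHom (map_smul g.toLin)
      map_deg := fun ht => tensorLift_mem (N := N) φ g.toLin.toAddMonoidHom (map_smul g.toLin)
        (fun _ _ hm => g.map_deg hm) ht }
  left_inv f := hom_ext (tensor_hom_ext φ fun b m => by
    refine (map_smul f.toLin b (tmk φ 1 m)).symm.trans ?_
    exact congrArg f.toLin ((smul_tmk φ b 1 m).trans (by rw [mul_one])))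
  right_inv g := hom_ext (LinearMap.ext fun m => one_smul B (show N.carrier from g.toLin m))

/-- Extension of scalars is left adjoint to restriction of scalars. -/
def baseChangeAdj (φ : A →ₐ[k] B) (hφ : ∀ j, ∀ a ∈ 𝒜 j, φ a ∈ ℬ j) :
    baseChange φ hφ ⊣ restrict φ hφ :=
  Adjunction.mkOfHomEquiv
    { homEquiv := baseChangeHomEquiv φ hφ
      homEquiv_naturality_left_symm := fun _ _ => hom_ext (tensor_hom_ext φ fun _ _ => rfl)
      homEquiv_naturality_right := fun _ _ => rfl }

instance (φ : A →ₐ[k] B) (hφ : ∀ j, ∀ a ∈ 𝒜 j, φ a ∈ ℬ j) : (restrict φ hφ).Faithful where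
  map_injective h := hom_ext (LinearMap.ext fun m =>
    LinearMap.congr_fun (congrArg Hom.toLin h) m)

end Restrict

/-! ### Graded submodules -/

section Sub

variable {k A : Type u} [Field k] [Ring A] [Algebra k A] {𝒜 : ℤ → Submodule k A}

/-- A graded module is a module over the base field. -/
instance baseModule (M : GrMod 𝒜) : Module k M.carrier := Module.compHom M.carrier (algebraMap k A)

theorem base_smul_def {M : GrMod 𝒜} (c : k) (m : M.carrier) : c • m = algebraMap k A c • m := rfl

instance (M : GrMod 𝒜) : IsScalarTower k A M.carrier :=
  ⟨fun c a m => by rw [base_smul_def, Algebra.smul_def, mul_smul]⟩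

theorem decompose_base_smul [GradedAlgebra 𝒜] {M : GrMod 𝒜} (c : k) (m : M.carrier) (i : ℤ) :
    (DirectSum.decompose M.deg (c • m) i : M.carrier) =
      c • (DirectSum.decompose M.deg m i : M.carrier) := by
  induction m using DirectSum.Decomposition.inductionOn M.deg with
  | zero => simp
  | add m m' h h' =>
    rw [smul_add, DirectSum.decompose_add, DirectSum.add_apply, AddSubgroup.coe_add, h, h',
      DirectSum.decompose_add, DirectSum.add_apply, AddSubgroup.coe_add, smul_add]
  | @homogeneous j m =>
    have hc : c • (m : M.carrier) ∈ M.deg j := by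
      have h := M.smul_mem (SetLike.algebraMap_mem_graded 𝒜 c) m.2
      rwa [zero_add] at h
    by_cases h : j = i
    · subst h
      rw [DirectSum.decompose_of_mem_same _ hc, DirectSum.decompose_of_mem_same _ m.2]
    · rw [DirectSum.decompose_of_mem_ne _ hc h, DirectSum.decompose_of_mem_ne _ m.2 h, smul_zero]

/-- A submodule of a graded module is homogeneous if it contains the homogeneous components of
its elements. -/
def IsHomogeneousSubmodule (M : GrMod 𝒜) (p : Submodule A M.carrier) : Prop :=
  ∀ x ∈ p, ∀ i, (DirectSum.decompose M.deg x i : M.carrier) ∈ p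

/-- A homogeneous submodule as a graded module. -/
def ofSubmodule (M : GrMod 𝒜) (p : Submodule A M.carrier) (hp : IsHomogeneousSubmodule M p) :
    GrMod 𝒜 where
  carrier := p
  deg i := (M.deg i).comap p.subtype.toAddMonoidHom
  isInternal := by
    classical
    constructor
    · rw [injective_iff_map_eq_zero]
      intro x hx
      have key : ∀ y : ⨁ i, ((M.deg i).comap p.subtype.toAddMonoidHom),
          DirectSum.decompose M.deg ((DirectSum.coeAddMonoidHom _ y : p) : M.carrier) =
          DirectSum.map (fun i => (p.subtype.toAddMonoidHom.addSubgroupComap (M.deg i))) y := by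
        intro y
        induction y using DirectSum.induction_on with
        | zero => simp
        | of i y =>
          rw [DirectSum.coeAddMonoidHom_of, DirectSum.map_of]
          exact DirectSum.decompose_of_mem M.deg y.2
        | add a b ha hb =>
          rw [map_add, map_add, ← ha, ← hb, Submodule.coe_add, DirectSum.decompose_add]
      have h := key x
      rw [hx, Submodule.coe_zero, DirectSum.decompose_zero] at h
      ext i
      have hi := congrArg (fun z => ((z i : M.deg i) : M.carrier)) h
      simp only [DirectSum.map_apply] at hi
      exact hi.symm
    · rintro ⟨m, hm⟩
      refine ⟨∑ i ∈ (DirectSum.decompose M.deg m).support, DirectSum.of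
        (fun i => (M.deg i).comap p.subtype.toAddMonoidHom) i
        ⟨⟨_, hp m hm i⟩, (DirectSum.decompose M.deg m i).2⟩, ?_⟩
      apply Subtype.ext
      rw [map_sum]
      simp only [DirectSum.coeAddMonoidHom_of]
      rw [AddSubmonoidClass.coe_finsetSum]
      exact DirectSum.sum_support_decompose M.deg m
  smul_mem ha hm := M.smul_mem ha hm

theorem IsHomogeneousSubmodule.bot (M : GrMod 𝒜) : IsHomogeneousSubmodule M ⊥ := by
  intro x hx i
  rw [(Submodule.mem_bot A).1 hx, DirectSum.decompose_zero]
  exact Submodule.zero_mem _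

theorem IsHomogeneousSubmodule.iSup {M : GrMod 𝒜} {ι : Type*} {p : ι → Submodule A M.carrier}
    (hp : ∀ j, IsHomogeneousSubmodule M (p j)) : IsHomogeneousSubmodule M (⨆ j, p j) := by
  intro x hx i
  induction hx using Submodule.iSup_induction' with
  | mem j x hx => exact Submodule.mem_iSup_of_mem j (hp j x hx i)
  | zero => rw [DirectSum.decompose_zero]; exact Submodule.zero_mem _
  | add x y _ _ hx hy =>
    rw [DirectSum.decompose_add, DirectSum.add_apply, AddSubgroup.coe_add]
    exact Submodule.add_mem _ hx hy

theorem IsHomogeneousSubmodule.sup {M : GrMod 𝒜} {p q : Submodule A M.carrier}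
    (hp : IsHomogeneousSubmodule M p) (hq : IsHomogeneousSubmodule M q) :
    IsHomogeneousSubmodule M (p ⊔ q) := by
  rw [sup_eq_iSup]
  exact .iSup fun b => by cases b <;> assumption

/-- The finite-dimensional homogeneous submodules of a graded module. -/
abbrev FinSub (M : GrMod 𝒜) : Type u :=
  {p : Submodule A M.carrier // IsHomogeneousSubmodule M p ∧ (p.restrictScalars k).FG}

theorem FinSub.finDim_ofSubmodule {M : GrMod 𝒜} (p : FinSub M) :
    finDim 𝒜 (ofSubmodule M p.1 p.2.1) := by
  have : Module.Finite k (p.1.restrictScalars k) := Module.Finite.iff_fg.2 p.2.2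
  exact this

theorem restrictScalars_iSup_fg {M : GrMod 𝒜} {ι : Type*} [Finite ι]
    {p : ι → Submodule A M.carrier} (hp : ∀ i, ((p i).restrictScalars k).FG) :
    ((⨆ i, p i).restrictScalars k).FG := by
  have h : (⨆ i, p i).restrictScalars k = ⨆ i, (p i).restrictScalars k :=
    map_iSup (Submodule.restrictScalarsLatticeHom k A M.carrier) p
  rw [h]
  exact Submodule.fg_iSup _ hp

theorem restrictScalars_sup_fg {M : GrMod 𝒜} {p q : Submodule A M.carrier}
    (hp : (p.restrictScalars k).FG) (hq : (q.restrictScalars k).FG) :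
    ((p ⊔ q).restrictScalars k).FG := by
  rw [sup_eq_iSup]
  exact restrictScalars_iSup_fg fun b => by cases b <;> assumption

instance (M : GrMod 𝒜) : SemilatticeSup (FinSub M) :=
  Subtype.semilatticeSup fun _ _ hp hq => ⟨hp.1.sup hq.1, restrictScalars_sup_fg hp.2 hq.2⟩

instance (M : GrMod 𝒜) : Nonempty (FinSub M) :=
  ⟨⟨⊥, .bot M, by
    rw [Submodule.restrictScalars_bot]; exact Submodule.fg_bot⟩⟩

/-- The diagram of the finite-dimensional homogeneous submodules. -/
def FinSub.diagram (M : GrMod 𝒜) : FinSub M ⥤ GrMod 𝒜 where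
  obj p := ofSubmodule M p.1 p.2.1
  map {p q} h := ⟨Submodule.inclusion (show p.1 ≤ q.1 from leOfHom h), fun hm => hm⟩

/-- A graded module as a cocone over its finite-dimensional homogeneous submodules. -/
def FinSub.cocone (M : GrMod 𝒜) : Limits.Cocone (FinSub.diagram M) where
  pt := M
  ι := { app := fun p => ⟨p.1.subtype, fun hm => hm⟩ }

/-- `M` is the union of its finite-dimensional homogeneous submodules. They are closed under sums,
so the union is directed and exhibits `M` as a filtered colimit. -/
theorem fdim_of_forall_mem_finSub {M : GrMod 𝒜} (h : ∀ m : M.carrier, ∃ p : FinSub M, m ∈ p.1) :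
    fdim 𝒜 M := by
  choose P hP using h
  -- The induced map sends `m` to its value on a chosen submodule containing it; comparison inside
  -- the sum of two submodules shows that the choice is irrelevant.
  have compat : ∀ (s : Limits.Cocone (FinSub.diagram M)) (p q : FinSub M) (m : M.carrier)
      (hp : m ∈ p.1) (hq : m ∈ q.1), (s.ι.app p).toLin ⟨m, hp⟩ = (s.ι.app q).toLin ⟨m, hq⟩ := by
    have aux : ∀ (s : Limits.Cocone (FinSub.diagram M)) (p q : FinSub M) (hpq : p ≤ q)
        (m : M.carrier) (hp : m ∈ p.1),
        (s.ι.app p).toLin ⟨m, hp⟩ = (s.ι.app q).toLin ⟨m, hpq hp⟩ := by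
      intro s p q hpq m hp
      rw [← s.w (homOfLE hpq)]
      rfl
    intro s p q m hp hq
    rw [aux s p (p ⊔ q) le_sup_left, aux s q (p ⊔ q) le_sup_right]
  let desc (s : Limits.Cocone (FinSub.diagram M)) : M ⟶ s.pt :=
    { toLin :=
        { toFun := fun m => (s.ι.app (P m)).toLin ⟨m, hP m⟩
          map_add' := fun m m' => by
            have h1 : m ∈ (P m ⊔ P m' : FinSub M).1 := Submodule.mem_sup_left (hP m)
            have h2 : m' ∈ (P m ⊔ P m' : FinSub M).1 := Submodule.mem_sup_right (hP m')
            rw [compat s _ (P m ⊔ P m') (m + m') _ (Submodule.add_mem _ h1 h2),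
              compat s _ (P m ⊔ P m') m _ h1, compat s _ (P m ⊔ P m') m' _ h2]
            exact map_add (s.ι.app (P m ⊔ P m')).toLin ⟨m, h1⟩ ⟨m', h2⟩
          map_smul' := fun a m => by
            rw [compat s _ (P m) (a • m) _ (Submodule.smul_mem _ a (hP m))]
            exact map_smul (s.ι.app (P m)).toLin a ⟨m, hP m⟩ }
      map_deg := fun {i m} hm => (s.ι.app (P m)).map_deg (m := ⟨m, hP m⟩) hm }
  refine ⟨FinSub M, inferInstance, inferInstance,
    { diag := FinSub.diagram M
      ι := (FinSub.cocone M).ι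
      isColimit :=
        { desc := desc
          fac := fun s p => hom_ext (LinearMap.ext fun m => compat s _ _ _ _ _)
          uniq := fun s f hf => hom_ext (LinearMap.ext fun m => ?_) } }, fun p => p.finDim_ofSubmodule⟩
  change f.toLin m = (s.ι.app (P m)).toLin ⟨m, hP m⟩
  rw [← hf]
  rfl

end Sub

end GrMod

/-! ### `Fdim` consists of the torsion modules -/

section Fdim

variable {k : Type u} [Field k] {n : ℕ}

theorem exists_forall_decompose_eq_zero {A : Type u} [Ring A] [Algebra k A]
    {𝒜 : ℤ → Submodule k A} [GradedAlgebra 𝒜] {M : GrMod 𝒜} (hM : GrMod.finDim 𝒜 M) :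
    ∃ b : ℤ, ∀ (m : M.carrier) (i : ℤ), b < i → DirectSum.decompose M.deg m i = 0 := by
  classical
  have hM' : Module.Finite k M.carrier := hM
  obtain ⟨S, hS⟩ := hM'.fg_top
  have hb : ∀ m : M.carrier, ∃ b : ℤ, ∀ i, b < i → DirectSum.decompose M.deg m i = 0 := by
    intro m
    obtain ⟨b, hb⟩ := (DirectSum.decompose M.deg m).support.exists_le
    refine ⟨b, fun i hi => ?_⟩
    by_contra h
    exact absurd (hb i (DFinsupp.mem_support_iff.2 h)) (not_le.2 hi)
  choose b hb using hb
  obtain ⟨c, hc⟩ := (S.image b).exists_le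
  refine ⟨c, fun m i hi => ?_⟩
  have hm : m ∈ Submodule.span k (S : Set M.carrier) := hS ▸ Submodule.mem_top
  induction hm using Submodule.span_induction with
  | mem m hm => exact hb m i ((hc _ (Finset.mem_image_of_mem b hm)).trans_lt hi)
  | zero => rw [DirectSum.decompose_zero, DirectSum.zero_apply]
  | add x y _ _ hx hy => rw [DirectSum.decompose_add, DirectSum.add_apply, hx, hy, add_zero]
  | smul a x _ hx =>
    refine Subtype.ext ?_
    rw [GrMod.decompose_base_smul, hx, AddSubgroup.coe_zero, smul_zero]

theorem isTorsionElt_of_finDim {M : GrMod (freeGrading k n)}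
    (hM : GrMod.finDim (freeGrading k n) M) (m : M.carrier) : IsTorsionElt k n m := by
  obtain ⟨b, hb⟩ := exists_forall_decompose_eq_zero hM
  induction m using DirectSum.Decomposition.inductionOn M.deg with
  | zero => exact ⟨0, fun l _ => smul_zero _⟩
  | add m m' h h' => exact h.add h'
  | @homogeneous j m =>
    -- Words of at least this length move degree `j` beyond the top degree `b`.
    refine ⟨(b - j + 1).toNat, fun l hl => ?_⟩
    have hmem := M.smul_mem (wordR_mem k l) m.2
    rw [← DirectSum.decompose_of_mem_same _ hmem, hb _ _ (by omega), AddSubgroup.coe_zero]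

/-- The unit `m ↦ 1 ⊗ m` and the zero map agree on every finite-dimensional stage, so by the
universal property of the colimit they agree on `M`. No description of the elements of a colimit is
needed. -/
theorem isTorsionElt_of_fdim {M : GrMod (freeGrading k n)}
    (hM : GrMod.fdim (freeGrading k n) M) (m : M.carrier) : IsTorsionElt k n m := by
  obtain ⟨J, _, _, pres, hJ⟩ := hM
  let z : M ⟶ (GrMod.restrict (freeToLeavitt k n) (freeToLeavitt_mem k n)).obj
      ((GrMod.baseChange (freeToLeavitt k n) (freeToLeavitt_mem k n)).obj M) :=
    ⟨0, fun _ => AddSubgroup.zero_mem _⟩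
  let η : M ⟶ (GrMod.restrict (freeToLeavitt k n) (freeToLeavitt_mem k n)).obj
      ((GrMod.baseChange (freeToLeavitt k n) (freeToLeavitt_mem k n)).obj M) :=
    GrMod.baseChangeHomEquiv (freeToLeavitt k n) (freeToLeavitt_mem k n) M _ (𝟙 _)
  have h : η = z := by
    refine pres.isColimit.hom_ext fun j => GrMod.hom_ext (LinearMap.ext fun x => ?_)
    obtain ⟨s, hs⟩ := isTorsionElt_of_finDim (hJ j) x
    refine tmk_one_eq_zero_iff.2 ⟨s, fun l hl => ?_⟩
    refine (map_smul (pres.ι.app j).toLin (wordR k l) x).symm.trans ?_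
    rw [hs l hl, map_zero]
  exact tmk_one_eq_zero_iff.1 (LinearMap.congr_fun (congrArg GrMod.Hom.toLin h) m)

theorem ι_mem (i : Fin (n + 1)) : FreeAlgebra.ι k i ∈ freeGrading k n 1 :=
  gen_mem_wordGrading (FreeAlgebra.ι k) (fun _ => 1) i

/-- Each `xᵢ m` is killed by all words of length one less, so by induction it lies in a
finite-dimensional homogeneous submodule `pᵢ`. Then `k m + ∑ pᵢ` is a submodule that contains `m`.
-/
theorem exists_finSub_of_homogeneous {M : GrMod (freeGrading k n)} (s : ℕ) {j : ℤ}
    {m : M.carrier} (hm : m ∈ M.deg j)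
    (hs : ∀ l : List (Fin (n + 1)), l.length = s → wordR k l • m = 0) :
    ∃ p : GrMod.FinSub M, m ∈ p.1 := by
  induction s generalizing j m with
  | zero =>
    obtain rfl : m = 0 := by simpa using hs [] rfl
    exact (inferInstance : Nonempty (GrMod.FinSub M)).elim fun p => ⟨p, p.1.zero_mem⟩
  | succ s ih =>
    have hx : ∀ i : Fin (n + 1), ∃ p : GrMod.FinSub M, FreeAlgebra.ι k i • m ∈ p.1 := fun i =>
      ih (M.smul_mem (ι_mem i) hm) fun l hl => by
        rw [← mul_smul, ← wordR_cons]
        exact hs _ (by simp [hl])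
    choose p hp using hx
    let q : Submodule (FreeAlg k n) M.carrier := ⨆ i, (p i).1
    have hq : GrMod.IsHomogeneousSubmodule M q := .iSup fun i => (p i).2.1
    have hqfg : (q.restrictScalars k).FG := GrMod.restrictScalars_iSup_fg fun i => (p i).2.2
    let V : Submodule k M.carrier := Submodule.span k {m} ⊔ q.restrictScalars k
    have hqV : ∀ y ∈ q, y ∈ V := fun y hy => Submodule.mem_sup_right hy
    have hmV : m ∈ V := Submodule.mem_sup_left (Submodule.mem_span_singleton_self m)
    have hV : ∀ (a : FreeAlg k n), ∀ v ∈ V, a • v ∈ V := by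
      intro a
      induction a using FreeAlgebra.induction with
      | grade0 c => exact fun v hv => V.smul_mem c hv
      | grade1 i =>
        intro v hv
        obtain ⟨_, hx, y, hy, rfl⟩ := Submodule.mem_sup.1 hv
        obtain ⟨c, rfl⟩ := Submodule.mem_span_singleton.1 hx
        refine hqV _ ?_
        rw [smul_add, GrMod.base_smul_def, ← mul_smul, ← Algebra.commutes, mul_smul]
        exact q.add_mem (q.smul_mem _ (Submodule.mem_iSup_of_mem i (hp i))) (q.smul_mem _ hy)
      | mul a b ha hb => intro v hv; rw [mul_smul]; exact ha _ (hb _ hv)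
      | add a b ha hb => intro v hv; rw [add_smul]; exact V.add_mem (ha _ hv) (hb _ hv)
    let P : Submodule (FreeAlg k n) M.carrier :=
      { V.toAddSubmonoid with smul_mem' := fun a v hv => hV a v hv }
    refine ⟨⟨P, ?_, ?_⟩, hmV⟩
    · intro v hv i
      obtain ⟨_, hx, y, hy, rfl⟩ := Submodule.mem_sup.1 (show v ∈ V from hv)
      obtain ⟨c, rfl⟩ := Submodule.mem_span_singleton.1 hx
      change _ ∈ V
      rw [DirectSum.decompose_add, DirectSum.add_apply, AddSubgroup.coe_add,
        GrMod.decompose_base_smul]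
      refine V.add_mem (V.smul_mem c ?_) (hqV _ (hq y hy i))
      by_cases h : j = i
      · subst h
        rwa [DirectSum.decompose_of_mem_same _ hm]
      · rw [DirectSum.decompose_of_mem_ne _ hm h]
        exact V.zero_mem
    · have hPV : P.restrictScalars k = V := rfl
      rw [hPV]
      exact (Submodule.fg_span_singleton m).sup hqfg

theorem fdim_iff_isTorsionElt {M : GrMod (freeGrading k n)} :
    GrMod.fdim (freeGrading k n) M ↔ ∀ m : M.carrier, IsTorsionElt k n m := by
  refine ⟨isTorsionElt_of_fdim, fun h => GrMod.fdim_of_forall_mem_finSub fun m => ?_⟩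
  induction m using DirectSum.Decomposition.inductionOn M.deg with
  | zero => exact (inferInstance : Nonempty (GrMod.FinSub M)).elim fun p => ⟨p, p.1.zero_mem⟩
  | homogeneous m =>
    obtain ⟨s, hs⟩ := h m
    exact exists_finSub_of_homogeneous s m.2 fun l hl => hs l hl.ge
  | add m m' h h' =>
    obtain ⟨p, hp⟩ := h
    obtain ⟨q, hq⟩ := h'
    exact ⟨p ⊔ q, Submodule.add_mem _ (Submodule.mem_sup_left hp) (Submodule.mem_sup_right hq)⟩

end Fdim

/-! ### The quotient category -/

section Quotient

variable (k : Type u) [Field k] (n : ℕ)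

theorem isoModFdim_eq_inverseImage :
    GrMod.isoModFdim (freeGrading k n) =
      (MorphismProperty.isomorphisms _).inverseImage (leavittTensor k n) := by
  ext M N f
  rw [MorphismProperty.inverseImage_iff, MorphismProperty.isomorphisms.iff,
    GrMod.isIso_iff_bijective]
  refine Iff.trans ?_ (and_congr (tensorMap_injective_iff f.toLin).symm
    (tensorMap_surjective_iff f.toLin).symm)
  refine and_congr (fdim_iff_isTorsionElt.trans ⟨?_, ?_⟩) fdim_iff_isTorsionElt
  · intro h m hm
    obtain ⟨s, hs⟩ := h ⟨m, hm⟩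
    exact ⟨s, fun l hl => congrArg Subtype.val (hs l hl)⟩
  · rintro h ⟨m, hm⟩
    obtain ⟨s, hs⟩ := h m hm
    exact ⟨s, fun l hl => Subtype.ext (hs l hl)⟩

/-- The action of `xⱼ*` is determined by that of the `xᵢ`: `f(xⱼ* x) = ∑ xᵢ* xᵢ f(xⱼ* x) = ∑ xᵢ*
f(xᵢ xⱼ* x) = xⱼ* f(x)`. This is the fullness of restriction of scalars. -/
theorem Leavitt.map_smul_of_map_x_smul {P Q : Type*} [AddCommGroup P] [Module (Leavitt k n) P]
    [AddCommGroup Q] [Module (Leavitt k n) Q] (f : P →+ Q)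
    (hf : ∀ (a : FreeAlg k n) (x : P), f (freeToLeavitt k n a • x) = freeToLeavitt k n a • f x)
    (b : Leavitt k n) (x : P) : f (b • x) = b • f x := by
  have key : ∀ (a : FreeAlgebra k (Fin (n + 1) ⊕ Fin (n + 1))) (x : P),
      f (Leavitt.mk k n a • x) = Leavitt.mk k n a • f x := by
    intro a
    induction a using FreeAlgebra.induction with
    | grade0 c =>
      intro x
      have h := hf (algebraMap k _ c) x
      rwa [AlgHom.commutes] at h ⊢
    | grade1 s =>
      intro x
      change f (Leavitt.gen k n s • x) = Leavitt.gen k n s • f x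
      have hx : ∀ (i : Fin (n + 1)) (x : P),
          f (Leavitt.gen k n (Sum.inl i) • x) = Leavitt.gen k n (Sum.inl i) • f x := by
        intro i x
        rw [← freeToLeavitt_ι, hf]
      cases s with
      | inl i => exact hx i x
      | inr j =>
        rw [← one_smul (Leavitt k n) (f _), ← Leavitt.sum_xs_mul_x, Finset.sum_smul,
          Finset.sum_eq_single j]
        · rw [mul_smul, ← hx, ← mul_smul, Leavitt.x_mul_xs_self, one_smul]
        · intro i _ hij
          rw [mul_smul, ← hx, ← mul_smul, Leavitt.x_mul_xs_ne k n i j hij, zero_smul, map_zero,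
            smul_zero]
        · simp
    | mul a b ha hb => intro x; rw [map_mul, mul_smul, ha, hb, mul_smul]
    | add a b ha hb => intro x; rw [map_add, add_smul, map_add, ha, hb, add_smul]
  obtain ⟨a, rfl⟩ := RingQuot.mkAlgHom_surjective k (LeavittRel k n) b
  exact key a x

instance : (GrMod.restrict (freeToLeavitt k n) (freeToLeavitt_mem k n)).Full where
  map_surjective {M N} f :=
    ⟨⟨{ toFun := f.toLin
        map_add' := map_add f.toLin
        map_smul' := Leavitt.map_smul_of_map_x_smul (P := M.carrier) (Q := N.carrier) k n
          f.toLin.toAddMonoidHom (map_smul f.toLin) }, fun hm => f.map_deg hm⟩, rfl⟩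

theorem leavittTensor_isLocalization :
    (leavittTensor k n).IsLocalization (GrMod.isoModFdim (freeGrading k n)) := by
  rw [isoModFdim_eq_inverseImage]
  exact (GrMod.baseChangeAdj (freeToLeavitt k n)
    (freeToLeavitt_mem k n)).isLocalization_leftAdjoint'

/-- The functor induced on the constructed localization satisfies the triangle as a strict equality,
not only up to isomorphism. -/
theorem exists_isEquivalence_comp_eq_leavittTensor :
    ∃ α : GrMod.QGr (freeGrading k n) ⥤ GrMod (leavittGrading k n),
      α.IsEquivalence ∧ GrMod.quotientFunctor (freeGrading k n) ⋙ α = leavittTensor k n := by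
  have := leavittTensor_isLocalization k n
  exact ⟨Localization.Construction.lift (leavittTensor k n)
    (Localization.inverts (leavittTensor k n) (GrMod.isoModFdim (freeGrading k n))),
    inferInstance, Localization.Construction.fac _ _⟩

end Quotient

end

end NCProj

theorem mainTheorem2 (k : Type u) [Field k] (n : ℕ) :
    IsStronglyGraded (leavittGrading k n) ∧
    Nonempty (leavittGrading k n 0 ≃ₐ[k] MatLimit k n) ∧
    (∃ α : GrMod.QGr (freeGrading k n) ⥤ GrMod (leavittGrading k n),
      α.IsEquivalence ∧ GrMod.quotientFunctor (freeGrading k n) ⋙ α = leavittTensor k n) ∧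
    (GrMod.degZero (leavittGrading k n)).IsEquivalence :=
  ⟨leavittGrading_isStronglyGraded k n, leavittGrading_zero_algEquiv k n,
    exists_isEquivalence_comp_eq_leavittTensor k n,
    GrMod.degZero_isEquivalence (leavittGrading_one_mem k n)⟩
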